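/- For $0<k<1$ let $K=K(k)$ and $E=E(k)$ be the complete elliptic integrals of the first and second kind with modulus $k$, let $k'=\sqrt{1-k^2}$, let $\operatorname{sn},\operatorname{cn},\operatorname{dn}$ be Jacobi's elliptic functions of modulus $k$, and let $Z(u)=\int_0^u\operatorname{dn}^2(t)\,dt-\frac{E}{K}u$ be Jacobi's zeta function. For $0<\lambda<\frac12$ put $$z^*=z^*(k,\lambda):=1+\frac{1}{\operatorname{dn}(2\lambda K)}\bigl(\operatorname{cn}(2\lambda K)-1+2\operatorname{sn}(2\lambda K)\,Z(\lambda K)\bigr).$$ Then, for all $0<k<1$ and $0<\lambda<\frac12$, $$z^*=\operatorname{cn}(2\lambda K)+\frac{\operatorname{sn}(2\lambda K)\,Z(2\lambda K)}{\operatorname{dn}(2\lambda K)}.$$ For every fixed $\lambda\in(0,\frac12)$, $z^*$ is strictly increasing as a function of $k\in(0,1)$. Moreover, for every fixed $\lambda\in(0,\frac12)$, $$z^*\to\cos(\lambda\pi)\quad\text{as }k\to0,\qquad z^*\sim\bigl(\tfrac12-\lambda\bigr)\Bigl(\frac{4}{k'}\Bigr)^{2\lambda}\to\infty\quad\text{as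 }k\to1,$$ where $f\sim g$ means $f/g\to1$. -/

import Mathlib

open Real Set Filter Topology MeasureTheory
open scoped Asymptotics

namespace Jacobi

/-- Legendre's incomplete elliptic integral of the first kind
`F(φ, k) = ∫₀^φ dθ / √(1 - k² sin² θ)`, of real amplitude `φ` and modulus `k`. -/
noncomputable def ellF (k φ : ℝ) : ℝ :=
  ∫ θ in (0 : ℝ)..φ, 1 / √(1 - k ^ 2 * sin θ ^ 2)

/-- The complete elliptic integral of the first kind
`K(k) = ∫₀^{π/2} dθ / √(1 - k² sin² θ)`. -/
noncomputable def ellK (k : ℝ) : ℝ :=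
  ∫ θ in (0 : ℝ)..(π / 2), 1 / √(1 - k ^ 2 * sin θ ^ 2)

/-- The complete elliptic integral of the second kind
`E(k) = ∫₀^{π/2} √(1 - k² sin² θ) dθ`. -/
noncomputable def ellE (k : ℝ) : ℝ :=
  ∫ θ in (0 : ℝ)..(π / 2), √(1 - k ^ 2 * sin θ ^ 2)

/-- Jacobi's amplitude `am(·, k)`: the inverse function of `φ ↦ F(φ, k)`, which is a bijection
of `ℝ` for `0 ≤ k < 1` (see `ellF_bijective`, `ellF_am`, `am_ellF`). -/
noncomputable def am (k : ℝ) : ℝ → ℝ :=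
  Function.invFun (ellF k)

/-- Jacobi's `sn(u) = sin am(u)`. -/
noncomputable def sn (k u : ℝ) : ℝ := sin (am k u)

/-- Jacobi's `cn(u) = cos am(u)`. -/
noncomputable def cn (k u : ℝ) : ℝ := cos (am k u)

/-- Jacobi's `dn(u) = √(1 - k² sn² u)`. -/
noncomputable def dn (k u : ℝ) : ℝ := √(1 - k ^ 2 * sn k u ^ 2)

/-- Jacobi's zeta function `Z(u) = ∫₀^u dn² t dt - (E/K) u`. -/
noncomputable def zn (k u : ℝ) : ℝ :=
  (∫ t in (0 : ℝ)..u, dn k t ^ 2) - ellE k / ellK k * u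

/-- The point `z* = 1 + (cn(2λK) - 1 + 2 sn(2λK) Z(λK)) / dn(2λK)`,
where `K = K(k)` and all functions have modulus `k`. -/
noncomputable def zStar (lam k : ℝ) : ℝ :=
  1 + 1 / dn k (2 * lam * ellK k) *
    (cn k (2 * lam * ellK k) - 1 + 2 * sn k (2 * lam * ellK k) * zn k (lam * ellK k))

/-! The amplitude is well defined: for `0 ≤ k < 1` the integral `F(·, k)` is a bijection of `ℝ`. -/

theorem radicand_pos {k : ℝ} (h0 : 0 ≤ k) (h1 : k < 1) (θ : ℝ) :
    0 < 1 - k ^ 2 * sin θ ^ 2 := by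
  nlinarith [sin_sq_le_one θ, sq_nonneg (sin θ), sq_nonneg k]

theorem continuous_integrand {k : ℝ} (h0 : 0 ≤ k) (h1 : k < 1) :
    Continuous fun θ : ℝ => 1 / √(1 - k ^ 2 * sin θ ^ 2) := by
  refine Continuous.div continuous_const (by fun_prop) fun θ => ?_
  exact (Real.sqrt_pos.2 (radicand_pos h0 h1 θ)).ne'

theorem one_le_integrand {k : ℝ} (h0 : 0 ≤ k) (h1 : k < 1) (θ : ℝ) :
    1 ≤ 1 / √(1 - k ^ 2 * sin θ ^ 2) := by
  rw [le_div_iff₀ (Real.sqrt_pos.2 (radicand_pos h0 h1 θ)), one_mul]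
  refine Real.sqrt_le_one.2 ?_
  nlinarith [mul_nonneg (sq_nonneg k) (sq_nonneg (sin θ))]

theorem sub_le_ellF_sub {k : ℝ} (h0 : 0 ≤ k) (h1 : k < 1) {a b : ℝ} (hab : a ≤ b) :
    b - a ≤ ellF k b - ellF k a := by
  have hc := continuous_integrand h0 h1
  unfold ellF
  rw [intervalIntegral.integral_interval_sub_left (hc.intervalIntegrable _ _)
    (hc.intervalIntegrable _ _)]
  have h := intervalIntegral.integral_mono_on hab (intervalIntegrable_const (μ := volume) (c := (1 : ℝ)))
    (hc.intervalIntegrable a b) fun θ _ => one_le_integrand h0 h1 θ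
  simpa using h

theorem ellF_bijective {k : ℝ} (h0 : 0 ≤ k) (h1 : k < 1) : Function.Bijective (ellF k) := by
  have hz : ellF k 0 = 0 := by simp [ellF]
  refine ⟨StrictMono.injective fun a b hab => ?_, ?_⟩
  · have := sub_le_ellF_sub h0 h1 hab.le
    linarith
  · have hcont : Continuous (ellF k) :=
      intervalIntegral.continuous_primitive
        (fun a b => (continuous_integrand h0 h1).intervalIntegrable a b) 0
    refine hcont.surjective ?_ ?_
    · refine tendsto_atTop_mono' atTop ?_ tendsto_id
      filter_upwards [eventually_ge_atTop 0] with x hx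
      have := sub_le_ellF_sub h0 h1 hx
      simp only [id]
      linarith
    · refine tendsto_atBot_mono' atBot ?_ tendsto_id
      filter_upwards [eventually_le_atBot 0] with x hx
      have := sub_le_ellF_sub h0 h1 hx
      simp only [id]
      linarith

theorem ellF_am {k : ℝ} (h0 : 0 ≤ k) (h1 : k < 1) (u : ℝ) : ellF k (am k u) = u :=
  Function.rightInverse_invFun (ellF_bijective h0 h1).surjective u

theorem am_ellF {k : ℝ} (h0 : 0 ≤ k) (h1 : k < 1) (φ : ℝ) : am k (ellF k φ) = φ :=
  Function.leftInverse_invFun (ellF_bijective h0 h1).injective φ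

end Jacobi

/-! Everything is expressed through the amplitude. Let F(φ), E(φ) be Legendre's incomplete integrals
and α = am(2λK), ζ = Z(2λK) = E(α) - 2λE, Δ = dn(2λK).

The identity rests on duplication: tan(am(2u)/2) = tan(am u) dn u and Z(2u) = 2Z(u) - k² sn²u sn 2u
(`ellF_dbl`, `ellEinc_dbl`). Both hold because the two sides agree at 0 and have equal derivatives
in φ. What then remains is (1 - cn 2u)(1 - dn 2u) = k² sn²u sn²2u.

For monotonicity, z* = cos α + ζ sin α / Δ is differentiated in k, with α defined implicitly by F(α)
= 2λK. The result factors (`hasDerivAt_zStar`) as ζ (Δ sin α - ζ cos α) / (k k'² Δ²). Here ζ > 0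
because dn² decreases on [0, K] (`ellE_mul_ellF_lt`), and ζ cos α < Δ sin α because E(φ) ≤ Δ(φ) tan
φ.

As k → 0, k' ≤ Δ ≤ 1 squeezes every integral. As k → 1, F(φ) is compared with ∫ sec = arsinh(tan φ);
the relative error is at most k' as long as k' tan²φ ≤ 1, that is, up to am(K/2). Since λ < 1/2,
this covers T = tan am(λK), so with L = log(4/k') one gets K = L + o(1) and T² ~ e^{2λL}/4.
Duplication carries this to Δ ~ 2e^{-2λL}; together with sin α → 1 and ζ → 1 - 2λ this gives the
asymptotics. -/

namespace Jacobi

/-- The radical `Δ(θ) = √(1 - k² sin² θ)`. -/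
noncomputable def delta (k θ : ℝ) : ℝ := √(1 - k ^ 2 * sin θ ^ 2)

/-- Legendre's incomplete elliptic integral of the second kind. -/
noncomputable def ellEinc (k φ : ℝ) : ℝ :=
  ∫ θ in (0 : ℝ)..φ, √(1 - k ^ 2 * sin θ ^ 2)

/-! ### Legendre integrals and Jacobi functions in terms of the amplitude -/

section Basic

variable {k : ℝ}

theorem delta_pos (h0 : 0 ≤ k) (h1 : k < 1) (θ : ℝ) : 0 < delta k θ :=
  Real.sqrt_pos.2 (radicand_pos h0 h1 θ)

theorem delta_sq (h0 : 0 ≤ k) (h1 : k < 1) (θ : ℝ) :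
    delta k θ ^ 2 = 1 - k ^ 2 * sin θ ^ 2 :=
  Real.sq_sqrt (radicand_pos h0 h1 θ).le

theorem continuous_delta : Continuous (delta k) := by
  unfold delta; fun_prop

theorem ellF_zero : ellF k 0 = 0 := by simp [ellF]

theorem ellEinc_zero : ellEinc k 0 = 0 := by simp [ellEinc]

theorem ellF_pi_div_two : ellF k (π / 2) = ellK k := rfl

theorem ellEinc_pi_div_two : ellEinc k (π / 2) = ellE k := rfl

theorem ellF_strictMono (h0 : 0 ≤ k) (h1 : k < 1) : StrictMono (ellF k) := fun a b hab => by
  have := sub_le_ellF_sub h0 h1 hab.le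
  linarith

theorem ellF_pos (h0 : 0 ≤ k) (h1 : k < 1) {φ : ℝ} (h : 0 < φ) : 0 < ellF k φ := by
  simpa [ellF_zero] using ellF_strictMono h0 h1 h

theorem ellK_pos (h0 : 0 ≤ k) (h1 : k < 1) : 0 < ellK k :=
  ellF_pos h0 h1 (by positivity)

theorem hasDerivAt_ellF (h0 : 0 ≤ k) (h1 : k < 1) (φ : ℝ) :
    HasDerivAt (ellF k) (1 / delta k φ) φ :=
  intervalIntegral.integral_hasDerivAt_right
    ((continuous_integrand h0 h1).intervalIntegrable _ _)
    ((continuous_integrand h0 h1).stronglyMeasurableAtFilter _ _)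
    (continuous_integrand h0 h1).continuousAt

theorem hasDerivAt_ellEinc (φ : ℝ) : HasDerivAt (ellEinc k) (delta k φ) φ :=
  intervalIntegral.integral_hasDerivAt_right
    ((continuous_delta (k := k)).intervalIntegrable _ _)
    ((continuous_delta (k := k)).stronglyMeasurableAtFilter _ _)
    (continuous_delta (k := k)).continuousAt

theorem hasDerivAt_delta (h0 : 0 ≤ k) (h1 : k < 1) (θ : ℝ) :
    HasDerivAt (delta k) (-(k ^ 2 * sin θ * cos θ) / delta k θ) θ := by
  have h := ((((hasDerivAt_sin θ).pow 2).const_mul (k ^ 2)).const_sub 1).sqrt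
    (radicand_pos h0 h1 θ).ne'
  refine h.congr_deriv ?_
  have := (delta_pos h0 h1 θ).ne'
  unfold delta at *
  simp only [Pi.pow_apply]
  field_simp
  norm_num
  ring

theorem am_strictMono (h0 : 0 ≤ k) (h1 : k < 1) : StrictMono (am k) := fun a b hab => by
  rw [← (ellF_strictMono h0 h1).lt_iff_lt, ellF_am h0 h1, ellF_am h0 h1]
  exact hab

theorem am_zero (h0 : 0 ≤ k) (h1 : k < 1) : am k 0 = 0 := by
  simpa [ellF_zero] using am_ellF h0 h1 0

theorem am_ellK (h0 : 0 ≤ k) (h1 : k < 1) : am k (ellK k) = π / 2 :=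
  am_ellF h0 h1 _

theorem continuous_am (h0 : 0 ≤ k) (h1 : k < 1) : Continuous (am k) :=
  (am_strictMono h0 h1).monotone.continuous_of_surjective
    fun φ => ⟨ellF k φ, am_ellF h0 h1 φ⟩

theorem dn_ellF (h0 : 0 ≤ k) (h1 : k < 1) (φ : ℝ) : dn k (ellF k φ) = delta k φ := by
  simp [dn, sn, delta, am_ellF h0 h1]

theorem continuous_dn (h0 : 0 ≤ k) (h1 : k < 1) : Continuous (dn k) := by
  have := continuous_am h0 h1
  unfold dn sn
  fun_prop

/-- The substitution t = F(θ) turns dn² t dt into Δ(θ) dθ. -/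
theorem zn_ellF (h0 : 0 ≤ k) (h1 : k < 1) (φ : ℝ) :
    zn k (ellF k φ) = ellEinc k φ - ellE k / ellK k * ellF k φ := by
  unfold zn
  congr 1
  have h := intervalIntegral.integral_comp_mul_deriv (a := 0) (b := φ) (f := ellF k)
    (f' := fun θ => 1 / delta k θ) (g := fun t => dn k t ^ 2)
    (fun x _ => hasDerivAt_ellF h0 h1 x) (continuous_integrand h0 h1).continuousOn
    ((continuous_dn h0 h1).pow 2)
  rw [ellF_zero] at h
  rw [← h]
  refine intervalIntegral.integral_congr fun θ _ => ?_
  have := (delta_pos h0 h1 θ).ne'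
  simp only [Function.comp, dn_ellF h0 h1]
  rw [← delta]
  field_simp

end Basic

/-! ### Duplication formulas and the closed form of z* -/

section Duplication

variable {k : ℝ}

/-- The amplitude of the doubled argument, as a function of the amplitude `φ ∈ (-π/2, π/2)`. -/
noncomputable def dbl (k φ : ℝ) : ℝ := 2 * arctan (tan φ * delta k φ)

theorem one_sub_sin_pow_four_pos (h0 : 0 ≤ k) (h1 : k < 1) (φ : ℝ) :
    0 < 1 - k ^ 2 * sin φ ^ 4 := by
  have h2 : k ^ 2 < 1 := by nlinarith
  have h3 := sin_sq_le_one φ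
  nlinarith [mul_le_one₀ h3 (sq_nonneg (sin φ)) h3, sq_nonneg k, sq_nonneg (sin φ ^ 2)]

theorem sin_two_mul_arctan (T : ℝ) : sin (2 * arctan T) = 2 * T / (1 + T ^ 2) := by
  have h : 0 < 1 + T ^ 2 := by positivity
  have h' := Real.sq_sqrt h.le
  have h'' := (Real.sqrt_pos.2 h).ne'
  rw [sin_two_mul, sin_arctan, cos_arctan]
  field_simp
  rw [h']

theorem cos_two_mul_arctan (T : ℝ) : cos (2 * arctan T) = (1 - T ^ 2) / (1 + T ^ 2) := by
  have h : 0 < 1 + T ^ 2 := by positivity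
  rw [cos_two_mul, cos_sq_arctan]
  field_simp
  ring

theorem one_add_sq_tan_mul_delta (h0 : 0 ≤ k) (h1 : k < 1) {φ : ℝ} (hc : 0 < cos φ) :
    1 + (tan φ * delta k φ) ^ 2 = (1 - k ^ 2 * sin φ ^ 4) / cos φ ^ 2 := by
  have hs := sin_sq_add_cos_sq φ
  rw [mul_pow, delta_sq h0 h1, tan_eq_sin_div_cos]
  field_simp
  linear_combination hs

theorem sin_dbl (h0 : 0 ≤ k) (h1 : k < 1) {φ : ℝ} (hc : 0 < cos φ) :
    sin (dbl k φ) = 2 * sin φ * cos φ * delta k φ / (1 - k ^ 2 * sin φ ^ 4) := by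
  have := (one_sub_sin_pow_four_pos h0 h1 φ).ne'
  rw [dbl, sin_two_mul_arctan, one_add_sq_tan_mul_delta h0 h1 hc, tan_eq_sin_div_cos]
  field_simp

theorem cos_dbl (h0 : 0 ≤ k) (h1 : k < 1) {φ : ℝ} (hc : 0 < cos φ) :
    cos (dbl k φ) =
      (cos φ ^ 2 - sin φ ^ 2 * delta k φ ^ 2) / (1 - k ^ 2 * sin φ ^ 4) := by
  have := (one_sub_sin_pow_four_pos h0 h1 φ).ne'
  rw [dbl, cos_two_mul_arctan, one_add_sq_tan_mul_delta h0 h1 hc, tan_eq_sin_div_cos]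
  field_simp

theorem delta_dbl (h0 : 0 ≤ k) (h1 : k < 1) {φ : ℝ} (hc : 0 < cos φ) :
    delta k (dbl k φ) =
      (delta k φ ^ 2 - k ^ 2 * sin φ ^ 2 * cos φ ^ 2) / (1 - k ^ 2 * sin φ ^ 4) := by
  have hD := one_sub_sin_pow_four_pos h0 h1 φ
  have hΔ := delta_sq h0 h1 φ
  have hcc := cos_sq' φ
  -- With s = sin φ the numerator is (1 - s²)² + (1 - k²) s² (2 - s²). Its sign matters because
  -- `delta` is the nonnegative root.
  have hN : 0 ≤ delta k φ ^ 2 - k ^ 2 * sin φ ^ 2 * cos φ ^ 2 := by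
    have h2 : k ^ 2 ≤ 1 := by nlinarith
    rw [hΔ, hcc]
    nlinarith [sq_nonneg (1 - sin φ ^ 2), mul_nonneg (sub_nonneg.2 h2)
      (mul_nonneg (sq_nonneg (sin φ)) (by linarith [sin_sq_le_one φ] : 0 ≤ 2 - sin φ ^ 2))]
  rw [delta, Real.sqrt_eq_iff_eq_sq (radicand_pos h0 h1 _).le (div_nonneg hN hD.le),
    sin_dbl h0 h1 hc, div_pow, div_pow, mul_pow, mul_pow, mul_pow, hΔ, hcc]
  field_simp
  ring

/-- This is Euler's equation dψ/Δ(ψ) = 2 dφ/Δ(φ) for ψ = `dbl k φ`; it makes ψ the amplitude of the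
doubled argument. -/
theorem hasDerivAt_dbl (h0 : 0 ≤ k) (h1 : k < 1) {φ : ℝ} (hc : 0 < cos φ) :
    HasDerivAt (dbl k) (2 * delta k (dbl k φ) / delta k φ) φ := by
  have h := (((hasDerivAt_tan hc.ne').mul (hasDerivAt_delta h0 h1 φ)).arctan).const_mul 2
  refine h.congr_deriv ?_
  have hD := (one_sub_sin_pow_four_pos h0 h1 φ).ne'
  have hΔ := (delta_pos h0 h1 φ).ne'
  simp only [Pi.mul_apply]
  rw [delta_dbl h0 h1 hc, one_add_sq_tan_mul_delta h0 h1 hc, tan_eq_sin_div_cos]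
  field_simp
  ring

theorem dbl_zero : dbl k 0 = 0 := by simp [dbl]

/-- Two functions that agree at `0` and have the same derivative on `[0, b]` agree at `b`. -/
theorem eq_of_hasDerivAt_eq {f g d : ℝ → ℝ} {b : ℝ} (hb : 0 ≤ b) (h : f 0 = g 0)
    (hf : ∀ x ∈ Icc 0 b, HasDerivAt f (d x) x) (hg : ∀ x ∈ Icc 0 b, HasDerivAt g (d x) x) :
    f b = g b := by
  have := constant_of_has_deriv_right_zero (f := fun x => f x - g x) (a := 0) (b := b)
    (fun x hx => ((hf x hx).sub (hg x hx)).continuousAt.continuousWithinAt)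
    (fun x hx => by
      simpa using! ((hf x (Ico_subset_Icc_self hx)).sub
        (hg x (Ico_subset_Icc_self hx))).hasDerivWithinAt) b ⟨hb, le_rfl⟩
  simp only [h, sub_self] at this
  linarith

theorem cos_pos_of_mem_Icc {b x : ℝ} (hb : b < π / 2) (hx : x ∈ Icc 0 b) : 0 < cos x :=
  cos_pos_of_mem_Ioo ⟨by linarith [hx.1, pi_pos], hx.2.trans_lt hb⟩

theorem ellF_dbl (h0 : 0 ≤ k) (h1 : k < 1) {φ : ℝ} (hφ : 0 ≤ φ) (hφ' : φ < π / 2) :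
    ellF k (dbl k φ) = 2 * ellF k φ := by
  refine eq_of_hasDerivAt_eq (f := fun φ => ellF k (dbl k φ)) (g := fun φ => 2 * ellF k φ)
    (d := fun φ => 2 * (1 / delta k φ)) hφ (by simp [dbl_zero, ellF_zero]) (fun x hx => ?_)
    fun x _ => (hasDerivAt_ellF h0 h1 x).const_mul 2
  have hc := cos_pos_of_mem_Icc hφ' hx
  refine ((hasDerivAt_ellF h0 h1 (dbl k x)).comp x (hasDerivAt_dbl h0 h1 hc)).congr_deriv ?_
  have := (delta_pos h0 h1 (dbl k x)).ne'
  field_simp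

theorem ellEinc_dbl (h0 : 0 ≤ k) (h1 : k < 1) {φ : ℝ} (hφ : 0 ≤ φ) (hφ' : φ < π / 2) :
    ellEinc k (dbl k φ) = 2 * ellEinc k φ - k ^ 2 * (sin φ ^ 2 * sin (dbl k φ)) := by
  refine eq_of_hasDerivAt_eq (f := fun φ => ellEinc k (dbl k φ))
    (g := fun φ => 2 * ellEinc k φ - k ^ 2 * (sin φ ^ 2 * sin (dbl k φ)))
    (d := fun φ => delta k (dbl k φ) * (2 * delta k (dbl k φ) / delta k φ)) hφ
    (by simp [dbl_zero, ellEinc_zero])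
    (fun x hx => (hasDerivAt_ellEinc (dbl k x)).comp x
      (hasDerivAt_dbl h0 h1 (cos_pos_of_mem_Icc hφ' hx))) fun x hx => ?_
  have hc := cos_pos_of_mem_Icc hφ' hx
  refine (((hasDerivAt_ellEinc x).const_mul 2).sub ((((hasDerivAt_sin x).pow 2).mul
    (hasDerivAt_dbl h0 h1 hc).sin).const_mul (k ^ 2))).congr_deriv ?_
  have hD := (one_sub_sin_pow_four_pos h0 h1 x).ne'
  have hΔ := (delta_pos h0 h1 x).ne'
  have hΔ2 := delta_sq h0 h1 x
  have hΔ4 : delta k x ^ 4 = (1 - k ^ 2 * sin x ^ 2) ^ 2 := by rw [← hΔ2]; ring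
  have hc2 := cos_sq' x
  have hc4 : cos x ^ 4 = (1 - sin x ^ 2) ^ 2 := by rw [← hc2]; ring
  simp only [Pi.pow_apply]
  rw [sin_dbl h0 h1 hc, cos_dbl h0 h1 hc, delta_dbl h0 h1 hc]
  field_simp
  ring_nf
  rw [hΔ4, hΔ2, hc4, hc2]
  ring

variable {lam : ℝ}

theorem am_mul_ellK_mem (h0 : 0 ≤ k) (h1 : k < 1) (hl0 : 0 < lam) (hl1 : lam < 1) :
    am k (lam * ellK k) ∈ Ioo 0 (π / 2) := by
  have hK := ellK_pos h0 h1
  constructor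
  · rw [← am_zero h0 h1]
    exact am_strictMono h0 h1 (by positivity)
  · rw [← am_ellK h0 h1]
    exact am_strictMono h0 h1 (by nlinarith)

theorem am_two_mul_mul_ellK (h0 : 0 ≤ k) (h1 : k < 1) (hl0 : 0 < lam) (hl1 : lam < 1) :
    am k (2 * lam * ellK k) = dbl k (am k (lam * ellK k)) := by
  obtain ⟨ha, hb⟩ := am_mul_ellK_mem h0 h1 hl0 hl1
  rw [← am_ellF h0 h1 (dbl k _), ellF_dbl h0 h1 ha.le hb, ellF_am h0 h1, mul_assoc]

theorem zn_eq (h0 : 0 ≤ k) (h1 : k < 1) (u : ℝ) :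
    zn k u = ellEinc k (am k u) - ellE k / ellK k * u := by
  conv_lhs => rw [← ellF_am h0 h1 u]
  rw [zn_ellF h0 h1, ellF_am h0 h1]

theorem zStar_eq (h0 : 0 ≤ k) (h1 : k < 1) (hl0 : 0 < lam) (hl1 : lam < 1) :
    zStar lam k = cn k (2 * lam * ellK k) +
      sn k (2 * lam * ellK k) * zn k (2 * lam * ellK k) / dn k (2 * lam * ellK k) := by
  have hmem := am_mul_ellK_mem h0 h1 hl0 hl1
  have ham := am_two_mul_mul_ellK h0 h1 hl0 hl1
  have hz2 := zn_eq h0 h1 (2 * lam * ellK k)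
  have hz1 := zn_eq h0 h1 (lam * ellK k)
  rw [ham, ellEinc_dbl h0 h1 hmem.1.le hmem.2] at hz2
  unfold zStar cn dn sn
  rw [hz2, hz1, ham]
  generalize am k (lam * ellK k) = φ at *
  have hc : 0 < cos φ := cos_pos_of_mem_Ioo ⟨by linarith [hmem.1, pi_pos], hmem.2⟩
  rw [← delta]
  have hd := (delta_pos h0 h1 (dbl k φ)).ne'
  -- The identity that survives after Z(2u) is replaced through Z(u): (1 - cn 2u)(1 - dn 2u) = k²
  -- sn²u sn²2u, expanded.
  have key : cos (dbl k φ) - 1 + k ^ 2 * sin φ ^ 2 * sin (dbl k φ) ^ 2 + delta k (dbl k φ)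
      - cos (dbl k φ) * delta k (dbl k φ) = 0 := by
    have hD := (one_sub_sin_pow_four_pos h0 h1 φ).ne'
    have hΔ2 := delta_sq h0 h1 φ
    rw [sin_dbl h0 h1 hc, cos_dbl h0 h1 hc, delta_dbl h0 h1 hc, div_pow, mul_pow, mul_pow, mul_pow,
      hΔ2, cos_sq']
    obtain ⟨D, hDe⟩ : ∃ D, D = 1 - k ^ 2 * sin φ ^ 4 := ⟨_, rfl⟩
    rw [← hDe] at hD ⊢
    field_simp
    rw [hDe]
    ring
  field_simp
  linear_combination key

end Duplication

/-! ### Chain rule and implicit differentiation along a curve -/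

section TwoVariables

variable {G g : ℝ → ℝ → ℝ} {p : ℝ → ℝ} {x : ℝ}

/-- The mean value theorem in φ alone supplies the secant slope, so the two lemmas below need only a
partial derivative in k at the fixed point `p x`, not joint differentiability of `G`. -/
theorem exists_mean_slope (hG : ∀ᶠ k in 𝓝 x, ∀ φ, HasDerivAt (G k) (g k φ) φ)
    (hg : ContinuousAt (fun q : ℝ × ℝ => g q.1 q.2) (x, p x)) (hp : ContinuousAt p x) :
    ∃ h : ℝ → ℝ, Tendsto h (𝓝 x) (𝓝 (g x (p x))) ∧
      ∀ᶠ k in 𝓝 x, G k (p k) - G k (p x) = h k * (p k - p x) := by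
  have hmvt : ∀ k, ∃ ξ, |ξ - p x| ≤ |p k - p x| ∧
      ((∀ φ, HasDerivAt (G k) (g k φ) φ) → G k (p k) - G k (p x) = g k ξ * (p k - p x)) := by
    intro k
    rcases lt_trichotomy (p k) (p x) with hlt | heq | hlt
    · by_cases hk : ∀ φ, HasDerivAt (G k) (g k φ) φ
      · obtain ⟨ξ, hξ, hs⟩ := exists_hasDerivAt_eq_slope (G k) (g k) hlt
          (fun y _ => (hk y).continuousAt.continuousWithinAt) fun y _ => hk y
        refine ⟨ξ, ?_, fun _ => ?_⟩
        · rw [abs_of_neg (by linarith [hξ.2]), abs_of_neg (by linarith)]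
          linarith [hξ.1]
        · have : p x - p k ≠ 0 := by linarith
          rw [hs]
          field_simp
          ring
      -- A harmless value of ξ: the distance bound must hold for every k, since it is what forces ξ
      -- → p x.
      · exact ⟨p x, by simp, fun h => absurd h hk⟩
    · exact ⟨p x, by simp, fun _ => by simp [heq]⟩
    · by_cases hk : ∀ φ, HasDerivAt (G k) (g k φ) φ
      · obtain ⟨ξ, hξ, hs⟩ := exists_hasDerivAt_eq_slope (G k) (g k) hlt
          (fun y _ => (hk y).continuousAt.continuousWithinAt) fun y _ => hk y
        refine ⟨ξ, ?_, fun _ => ?_⟩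
        · rw [abs_of_pos (by linarith [hξ.1]), abs_of_pos (by linarith)]
          linarith [hξ.2]
        · have : p k - p x ≠ 0 := by linarith
          rw [hs]
          field_simp
      · exact ⟨p x, by simp, fun h => absurd h hk⟩
  choose ξ hξ hξ' using hmvt
  refine ⟨fun k => g k (ξ k), ?_, hG.mono fun k hk => hξ' k hk⟩
  have h1 : Tendsto ξ (𝓝 x) (𝓝 (p x)) := by
    rw [tendsto_iff_dist_tendsto_zero]
    refine squeeze_zero (fun _ => dist_nonneg) (fun k => hξ k) ?_
    have := tendsto_iff_dist_tendsto_zero.1 hp.tendsto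
    simpa [Real.dist_eq] using this
  exact hg.tendsto.comp (tendsto_id.prodMk_nhds h1)

theorem hasDerivAt_along_curve {a p' : ℝ} (hG : ∀ᶠ k in 𝓝 x, ∀ φ, HasDerivAt (G k) (g k φ) φ)
    (hg : ContinuousAt (fun q : ℝ × ℝ => g q.1 q.2) (x, p x)) (hp : HasDerivAt p p' x)
    (ha : HasDerivAt (fun k => G k (p x)) a x) :
    HasDerivAt (fun k => G k (p k)) (a + g x (p x) * p') x := by
  obtain ⟨h, hh, he⟩ := exists_mean_slope hG hg hp.continuousAt
  rw [hasDerivAt_iff_tendsto_slope] at *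
  refine ((ha.add ((hh.mono_left nhdsWithin_le_nhds).mul hp))).congr' ?_
  filter_upwards [nhdsWithin_le_nhds he] with k hk
  simp only [slope_def_field]
  rw [show G k (p k) = G k (p x) + h k * (p k - p x) by linarith]
  ring

theorem hasDerivAt_implicit {a c : ℝ} (hG : ∀ᶠ k in 𝓝 x, ∀ φ, HasDerivAt (G k) (g k φ) φ)
    (hg : ContinuousAt (fun q : ℝ × ℝ => g q.1 q.2) (x, p x)) (hp : ContinuousAt p x)
    (ha : HasDerivAt (fun k => G k (p x)) a x) (hc : HasDerivAt (fun k => G k (p k)) c x)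
    (h0 : g x (p x) ≠ 0) : HasDerivAt p ((c - a) / g x (p x)) x := by
  obtain ⟨h, hh, he⟩ := exists_mean_slope hG hg hp
  rw [hasDerivAt_iff_tendsto_slope] at *
  refine ((hc.sub ha).div (hh.mono_left nhdsWithin_le_nhds) h0).congr' ?_
  filter_upwards [nhdsWithin_le_nhds he, nhdsWithin_le_nhds (hh.eventually_ne h0)] with k hk hk0
  simp only [Pi.div_apply, slope_def_field]
  rw [show G k (p k) = G k (p x) + h k * (p k - p x) by linarith]
  field_simp
  ring

end TwoVariables

/-! ### Derivatives with respect to the modulus -/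

section Modulus

variable {k : ℝ}

theorem delta_anti {x y : ℝ} (h0 : 0 ≤ x) (hxy : x ≤ y) (θ : ℝ) : delta y θ ≤ delta x θ := by
  refine Real.sqrt_le_sqrt ?_
  have : x ^ 2 ≤ y ^ 2 := by gcongr
  nlinarith [sq_nonneg (sin θ)]

theorem delta_le_one (k θ : ℝ) : delta k θ ≤ 1 := by
  refine Real.sqrt_le_one.2 ?_
  nlinarith [mul_nonneg (sq_nonneg k) (sq_nonneg (sin θ))]

theorem hasDerivAt_delta_modulus (h0 : 0 ≤ k) (h1 : k < 1) (θ : ℝ) :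
    HasDerivAt (fun k => delta k θ) (-(k * sin θ ^ 2) / delta k θ) k := by
  have h := (((hasDerivAt_pow 2 k).mul_const (sin θ ^ 2)).const_sub 1).sqrt
    (radicand_pos h0 h1 θ).ne'
  refine h.congr_deriv ?_
  have := (delta_pos h0 h1 θ).ne'
  unfold delta at *
  field_simp
  norm_num
  ring

theorem hasDerivAt_ellF_modulus_integral (h0 : 0 < k) (h1 : k < 1) (φ : ℝ) :
    -- The modulus is kept below some r < 1 in the proof, so that 1/Δ_r³ dominates the derivative of
    -- the integrand.
    HasDerivAt (fun k => ellF k φ) (∫ θ in (0 : ℝ)..φ, k * sin θ ^ 2 / delta k θ ^ 3) k := by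
  obtain ⟨r, hkr, hr1⟩ := exists_between h1
  have hr0 : 0 < r := h0.trans hkr
  have hcont : ∀ {x : ℝ}, 0 ≤ x → x < 1 → Continuous fun θ => 1 / delta x θ ^ 3 :=
    fun hx hx1 => continuous_const.div (continuous_delta.pow 3)
      fun θ => (pow_pos (delta_pos hx hx1 θ) 3).ne'
  have hcont' : Continuous fun θ => k * sin θ ^ 2 / delta k θ ^ 3 :=
    Continuous.div (by fun_prop) (continuous_delta.pow 3)
      fun θ => (pow_pos (delta_pos h0.le h1 θ) 3).ne'
  refine (intervalIntegral.hasDerivAt_integral_of_dominated_loc_of_deriv_le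
    (F := fun k θ => 1 / √(1 - k ^ 2 * sin θ ^ 2))
    (F' := fun k θ => k * sin θ ^ 2 / delta k θ ^ 3)
    (bound := fun θ => 1 / delta r θ ^ 3) (s := Ioo 0 r) (Ioo_mem_nhds h0 hkr) ?_
    ((continuous_integrand h0.le h1).intervalIntegrable _ _) hcont'.aestronglyMeasurable ?_
    ((hcont hr0.le hr1).intervalIntegrable _ _) ?_).2
  · filter_upwards [Ioo_mem_nhds h0 h1] with x hx
    exact (continuous_integrand hx.1.le hx.2).aestronglyMeasurable
  · refine Eventually.of_forall fun θ _ x hx => ?_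
    have hx1 := hx.2.trans hr1
    have hd := delta_pos hx.1.le hx1 θ
    have hd' := delta_pos hr0.le hr1 θ
    have hnum : x * sin θ ^ 2 ≤ 1 := mul_le_one₀ hx1.le (sq_nonneg _) (sin_sq_le_one θ)
    have hx0 := hx.1.le
    rw [Real.norm_of_nonneg (by positivity)]
    have := delta_anti hx.1.le hx.2.le θ
    gcongr
  · refine Eventually.of_forall fun θ _ x hx => ?_
    have hx1 := hx.2.trans hr1
    have hd := (delta_pos hx.1.le hx1 θ).ne'
    have h := (hasDerivAt_delta_modulus hx.1.le hx1 θ).inv hd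
    have he : (fun k => 1 / √(1 - k ^ 2 * sin θ ^ 2)) = (fun k => delta k θ)⁻¹ := by
      ext; simp [delta]
    rw [he]
    refine h.congr_deriv ?_
    field_simp

theorem hasDerivAt_ellEinc_modulus_integral (h0 : 0 < k) (h1 : k < 1) (φ : ℝ) :
    HasDerivAt (fun k => ellEinc k φ) (∫ θ in (0 : ℝ)..φ, -(k * sin θ ^ 2) / delta k θ) k := by
  obtain ⟨r, hkr, hr1⟩ := exists_between h1
  have hr0 : 0 < r := h0.trans hkr
  have hcont' : Continuous fun θ => -(k * sin θ ^ 2) / delta k θ :=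
    Continuous.div (by fun_prop) continuous_delta fun θ => (delta_pos h0.le h1 θ).ne'
  refine (intervalIntegral.hasDerivAt_integral_of_dominated_loc_of_deriv_le
    (F := delta) (F' := fun k θ => -(k * sin θ ^ 2) / delta k θ)
    (bound := fun θ => 1 / delta r θ) (s := Ioo 0 r) (Ioo_mem_nhds h0 hkr) ?_
    (continuous_delta.intervalIntegrable _ _) hcont'.aestronglyMeasurable ?_
    ((continuous_integrand hr0.le hr1).intervalIntegrable _ _) ?_).2
  · exact Eventually.of_forall fun x => continuous_delta.aestronglyMeasurable
  · refine Eventually.of_forall fun θ _ x hx => ?_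
    have hx1 := hx.2.trans hr1
    have hd := delta_pos hx.1.le hx1 θ
    have hd' := delta_pos hr0.le hr1 θ
    have hnum : x * sin θ ^ 2 ≤ 1 := mul_le_one₀ hx1.le (sq_nonneg _) (sin_sq_le_one θ)
    have hx0 := hx.1.le
    rw [neg_div, norm_neg, Real.norm_of_nonneg (by positivity)]
    have := delta_anti hx.1.le hx.2.le θ
    gcongr
  · exact Eventually.of_forall fun θ _ x hx =>
      hasDerivAt_delta_modulus hx.1.le (hx.2.trans hr1) θ

/-- The closed form is a primitive in φ of k sin²φ/Δ³ that vanishes at 0; its boundary term drops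
out at φ = π/2, which gives the derivative of K. -/
theorem hasDerivAt_ellF_modulus (h0 : 0 < k) (h1 : k < 1) {φ : ℝ} (hφ : 0 ≤ φ) :
    HasDerivAt (fun k => ellF k φ)
      ((ellEinc k φ - (1 - k ^ 2) * ellF k φ) / (k * (1 - k ^ 2)) -
        k / (1 - k ^ 2) * (sin φ * cos φ / delta k φ)) k := by
  refine (hasDerivAt_ellF_modulus_integral h0 h1 φ).congr_deriv ?_
  have hcont' : Continuous fun θ => k * sin θ ^ 2 / delta k θ ^ 3 :=
    Continuous.div (by fun_prop) (continuous_delta.pow 3)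
      fun θ => (pow_pos (delta_pos h0.le h1 θ) 3).ne'
  refine eq_of_hasDerivAt_eq (f := fun φ => ∫ θ in (0 : ℝ)..φ, k * sin θ ^ 2 / delta k θ ^ 3)
    (d := fun θ => k * sin θ ^ 2 / delta k θ ^ 3)
    (g := fun φ => (ellEinc k φ - (1 - k ^ 2) * ellF k φ) / (k * (1 - k ^ 2)) -
        k / (1 - k ^ 2) * (sin φ * cos φ / delta k φ)) hφ (by simp [ellF_zero, ellEinc_zero])
    (fun x _ => intervalIntegral.integral_hasDerivAt_right (hcont'.intervalIntegrable _ _)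
      (hcont'.stronglyMeasurableAtFilter _ _) hcont'.continuousAt) fun x _ => ?_
  have hd := (delta_pos h0.le h1 x).ne'
  refine ((((hasDerivAt_ellEinc x).sub ((hasDerivAt_ellF h0.le h1 x).const_mul (1 - k ^ 2))).div_const
    (k * (1 - k ^ 2))).sub ((((hasDerivAt_sin x).mul (hasDerivAt_cos x)).div
      (hasDerivAt_delta h0.le h1 x) hd).const_mul (k / (1 - k ^ 2)))).congr_deriv ?_
  have hk : 1 - k ^ 2 ≠ 0 := by nlinarith
  have hΔ2 := delta_sq h0.le h1 x
  have hΔ4 : delta k x ^ 4 = (1 - k ^ 2 * sin x ^ 2) ^ 2 := by rw [← hΔ2]; ring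
  have hc2 := cos_sq' x
  simp only [Pi.mul_apply]
  field_simp
  ring_nf
  rw [hΔ4, hΔ2, hc2]
  ring

theorem hasDerivAt_ellEinc_modulus (h0 : 0 < k) (h1 : k < 1) (φ : ℝ) :
    HasDerivAt (fun k => ellEinc k φ) ((ellEinc k φ - ellF k φ) / k) k := by
  refine (hasDerivAt_ellEinc_modulus_integral h0 h1 φ).congr_deriv ?_
  unfold ellEinc ellF
  have hcd : Continuous fun θ => √(1 - k ^ 2 * sin θ ^ 2) := continuous_delta
  rw [← intervalIntegral.integral_sub (hcd.intervalIntegrable _ _)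
    ((continuous_integrand h0.le h1).intervalIntegrable _ _), ← intervalIntegral.integral_div]
  refine intervalIntegral.integral_congr fun θ _ => ?_
  have hd := (delta_pos h0.le h1 θ).ne'
  have hΔ2 := delta_sq h0.le h1 θ
  rw [← delta]
  field_simp
  linear_combination -hΔ2

theorem hasDerivAt_ellK (h0 : 0 < k) (h1 : k < 1) :
    HasDerivAt ellK ((ellE k - (1 - k ^ 2) * ellK k) / (k * (1 - k ^ 2))) k := by
  simpa [ellF_pi_div_two, ellEinc_pi_div_two] using!
    hasDerivAt_ellF_modulus h0 h1 (φ := π / 2) (by positivity)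

theorem hasDerivAt_ellE (h0 : 0 < k) (h1 : k < 1) :
    HasDerivAt ellE ((ellE k - ellK k) / k) k :=
  hasDerivAt_ellEinc_modulus h0 h1 (π / 2)

theorem continuous_uncurry_delta : Continuous fun q : ℝ × ℝ => delta q.1 q.2 := by
  unfold delta; fun_prop

variable {lam : ℝ}

/-- The amplitude `am(2λK)` as a function of the modulus. -/
noncomputable def ampl (lam k : ℝ) : ℝ := am k (2 * lam * ellK k)

/-- The value `Z(2λK)` as a function of the modulus. -/
noncomputable def zeta (lam k : ℝ) : ℝ := ellEinc k (ampl lam k) - 2 * lam * ellE k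

theorem ellF_ampl (h0 : 0 ≤ k) (h1 : k < 1) : ellF k (ampl lam k) = 2 * lam * ellK k :=
  ellF_am h0 h1 _

theorem ampl_mem (h0 : 0 ≤ k) (h1 : k < 1) (hl0 : 0 < lam) (hl1 : lam < 1 / 2) :
    ampl lam k ∈ Ioo 0 (π / 2) :=
  am_mul_ellK_mem h0 h1 (by linarith) (by linarith)

theorem zStar_eq_ampl (h0 : 0 ≤ k) (h1 : k < 1) (hl0 : 0 < lam) (hl1 : lam < 1 / 2) :
    zStar lam k = cos (ampl lam k) +
      sin (ampl lam k) * zeta lam k / delta k (ampl lam k) := by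
  have hK := (ellK_pos h0 h1).ne'
  rw [zStar_eq h0 h1 hl0 (by linarith), zn_eq h0 h1]
  unfold cn dn sn zeta delta ampl
  congr 3
  field_simp

/-- F does not shrink distances (its integrand is at least 1), so the displacement of α is at most
that of F(α) at the new modulus, and F(α) = 2λK is known. -/
theorem continuousAt_ampl (h0 : 0 < k) (h1 : k < 1) (hl0 : 0 < lam) (hl1 : lam < 1 / 2) :
    ContinuousAt (ampl lam) k := by
  have hφ := (ampl_mem h0.le h1 hl0 hl1).1.le
  have hbound : ∀ᶠ x in 𝓝 k, dist (ampl lam x) (ampl lam k) ≤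
      |2 * lam * ellK x - ellF x (ampl lam k)| := by
    filter_upwards [Ioo_mem_nhds h0 h1] with x hx
    rw [← ellF_ampl hx.1.le hx.2, Real.dist_eq]
    rcases le_total (ampl lam x) (ampl lam k) with h | h
    · have := sub_le_ellF_sub hx.1.le hx.2 h
      rw [abs_sub_comm, abs_of_nonneg (by linarith), abs_sub_comm]
      exact this.trans (le_abs_self _)
    · have := sub_le_ellF_sub hx.1.le hx.2 h
      rw [abs_of_nonneg (by linarith)]
      exact this.trans (le_abs_self _)
  have hlim : Tendsto (fun x => |2 * lam * ellK x - ellF x (ampl lam k)|) (𝓝 k) (𝓝 0) := by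
    have h := ((((hasDerivAt_ellK h0 h1).const_mul (2 * lam)).sub
      (hasDerivAt_ellF_modulus h0 h1 hφ)).continuousAt.tendsto).abs
    simpa [ellF_ampl h0.le h1] using! h
  exact tendsto_iff_dist_tendsto_zero.2
    (squeeze_zero' (Eventually.of_forall fun _ => dist_nonneg) hbound hlim)

theorem hasDerivAt_ampl (h0 : 0 < k) (h1 : k < 1) (hl0 : 0 < lam) (hl1 : lam < 1 / 2) :
    HasDerivAt (ampl lam)
      ((k ^ 2 * sin (ampl lam k) * cos (ampl lam k) - delta k (ampl lam k) * zeta lam k) /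
        (k * (1 - k ^ 2))) k := by
  have hφ := (ampl_mem h0.le h1 hl0 hl1).1.le
  have hd := delta_pos h0.le h1 (ampl lam k)
  have hk : 1 - k ^ 2 ≠ 0 := by nlinarith
  refine (hasDerivAt_implicit (G := ellF) (g := fun k φ => 1 / delta k φ)
    (c := 2 * lam * ((ellE k - (1 - k ^ 2) * ellK k) / (k * (1 - k ^ 2)))) ?_ ?_
    (continuousAt_ampl h0 h1 hl0 hl1) (hasDerivAt_ellF_modulus h0 h1 hφ) ?_
    (by positivity)).congr_deriv ?_
  · filter_upwards [Ioo_mem_nhds h0 h1] with x hx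
    exact hasDerivAt_ellF hx.1.le hx.2
  · exact ContinuousAt.div continuousAt_const continuous_uncurry_delta.continuousAt hd.ne'
  · refine ((hasDerivAt_ellK h0 h1).const_mul (2 * lam)).congr_of_eventuallyEq ?_
    filter_upwards [Ioo_mem_nhds h0 h1] with x hx
    exact ellF_ampl hx.1.le hx.2
  · rw [ellF_ampl h0.le h1, zeta]
    field_simp
    ring

/-- Since F(α) = 2λK, the explicit k-derivatives of E(α) and 2λE combine to ζ/k; the rest is Δ times
the derivative of α. -/
theorem hasDerivAt_zeta (h0 : 0 < k) (h1 : k < 1) (hl0 : 0 < lam) (hl1 : lam < 1 / 2) :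
    HasDerivAt (zeta lam)
      (k * cos (ampl lam k) * (sin (ampl lam k) * delta k (ampl lam k) -
        cos (ampl lam k) * zeta lam k) / (1 - k ^ 2)) k := by
  have hk : 1 - k ^ 2 ≠ 0 := by nlinarith
  refine ((hasDerivAt_along_curve (G := ellEinc) (g := delta)
    (Eventually.of_forall fun x φ => hasDerivAt_ellEinc φ) continuous_uncurry_delta.continuousAt
    (hasDerivAt_ampl h0 h1 hl0 hl1) (hasDerivAt_ellEinc_modulus h0 h1 _)).sub
    ((hasDerivAt_ellE h0 h1).const_mul (2 * lam))).congr_deriv ?_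
  have hΔ2 := delta_sq h0.le h1 (ampl lam k)
  have hc2 := cos_sq' (ampl lam k)
  have hz : ellEinc k (ampl lam k) = zeta lam k + 2 * lam * ellE k := by rw [zeta]; ring
  rw [ellF_ampl h0.le h1, hz]
  field_simp
  ring_nf
  rw [hΔ2, hc2]
  ring

/-- The terms free of ζ, namely ∓ k sin²α cos α / k'² from cos α and from the derivative of ζ,
cancel; hence the factor ζ. -/
theorem hasDerivAt_zStar (h0 : 0 < k) (h1 : k < 1) (hl0 : 0 < lam) (hl1 : lam < 1 / 2) :
    HasDerivAt (zStar lam)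
      (zeta lam k * (sin (ampl lam k) * delta k (ampl lam k) - cos (ampl lam k) * zeta lam k) /
        (k * (1 - k ^ 2) * delta k (ampl lam k) ^ 2)) k := by
  have hd := (delta_pos h0.le h1 (ampl lam k)).ne'
  have hk : 1 - k ^ 2 ≠ 0 := by nlinarith
  have hp := hasDerivAt_ampl h0 h1 hl0 hl1
  have hdelta := hasDerivAt_along_curve (G := delta)
    (g := fun k φ => -(k ^ 2 * sin φ * cos φ) / delta k φ) (p := ampl lam) (x := k)
    (by filter_upwards [Ioo_mem_nhds h0 h1] with x hx
        exact hasDerivAt_delta hx.1.le hx.2)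
    (ContinuousAt.div (by fun_prop) continuous_uncurry_delta.continuousAt hd) hp
    (hasDerivAt_delta_modulus h0.le h1 _)
  have h := hp.cos.add ((hp.sin.mul (hasDerivAt_zeta h0 h1 hl0 hl1)).div hdelta hd)
  refine (h.congr_of_eventuallyEq ?_).congr_deriv ?_
  · filter_upwards [Ioo_mem_nhds h0 h1] with x hx
    exact zStar_eq_ampl hx.1.le hx.2 hl0 hl1
  · have hΔ2 := delta_sq h0.le h1 (ampl lam k)
    have hc2 := cos_sq' (ampl lam k)
    simp only [Pi.mul_apply]
    have hΔ4 : delta k (ampl lam k) ^ 4 = (1 - k ^ 2 * sin (ampl lam k) ^ 2) ^ 2 := by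
      rw [← hΔ2]; ring
    have hΔ3 : delta k (ampl lam k) ^ 3 =
        delta k (ampl lam k) * (1 - k ^ 2 * sin (ampl lam k) ^ 2) := by
      rw [← hΔ2]; ring
    field_simp
    ring_nf
    rw [hΔ4, hΔ3, hΔ2, hc2]
    ring

end Modulus

/-! ### Positivity of the derivative -/

section Monotone

variable {k : ℝ}

/-- E(φ)/F(φ) is the mean of Δ² on [0, φ] for the weight 1/Δ. As Δ decreases, this mean exceeds
Δ(φ)², while the mean over [φ, π/2] is at most Δ(φ)². -/
theorem ellE_mul_ellF_lt (h0 : 0 < k) (h1 : k < 1) {φ : ℝ} (hφ : φ ∈ Ioo 0 (π / 2)) :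
    ellE k * ellF k φ < ellEinc k φ * ellK k := by
  have hcd : Continuous fun θ => √(1 - k ^ 2 * sin θ ^ 2) := continuous_delta
  have hci := continuous_integrand h0.le h1
  have hF := ellF_pos h0.le h1 hφ.1
  have hFK : ellF k φ < ellK k := ellF_strictMono h0.le h1 hφ.2
  have hanti : StrictAntiOn (fun θ => delta k θ) (Icc 0 (π / 2)) := by
    intro a ha b hb hab
    refine Real.sqrt_lt_sqrt (radicand_pos h0.le h1 b).le ?_
    have hs : sin a < sin b := sin_lt_sin_of_lt_of_le_pi_div_two
      (by linarith [ha.1, pi_pos]) hb.2 hab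
    have hs0 : 0 ≤ sin a := sin_nonneg_of_nonneg_of_le_pi ha.1 (by linarith [ha.2, pi_pos])
    have : sin a ^ 2 < sin b ^ 2 := by gcongr
    have : 0 < k ^ 2 := by positivity
    nlinarith
  have hlow : delta k φ ^ 2 * ellF k φ < ellEinc k φ := by
    unfold ellF ellEinc
    rw [← intervalIntegral.integral_const_mul]
    refine intervalIntegral.integral_lt_integral_of_continuousOn_of_le_of_exists_lt hφ.1
      (hci.const_mul _).continuousOn hcd.continuousOn (fun θ hθ => ?_) ⟨0, ⟨le_rfl, hφ.1.le⟩, ?_⟩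
    · have hd := delta_pos h0.le h1 θ
      have hle := hanti.antitoneOn ⟨hθ.1.le, hθ.2.trans hφ.2.le⟩ ⟨hφ.1.le, hφ.2.le⟩ hθ.2
      have := (delta_pos h0.le h1 φ).le
      rw [← delta, mul_one_div, div_le_iff₀ hd]
      nlinarith
    · have hlt := hanti ⟨le_rfl, by positivity⟩ ⟨hφ.1.le, hφ.2.le⟩ hφ.1
      have hd := delta_pos h0.le h1 0
      have := (delta_pos h0.le h1 φ).le
      rw [← delta, mul_one_div, div_lt_iff₀ hd]
      nlinarith
  have hhigh : ellE k - ellEinc k φ ≤ delta k φ ^ 2 * (ellK k - ellF k φ) := by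
    unfold ellE ellEinc ellK ellF
    rw [intervalIntegral.integral_interval_sub_left (hcd.intervalIntegrable _ _)
      (hcd.intervalIntegrable _ _), intervalIntegral.integral_interval_sub_left
      (hci.intervalIntegrable _ _) (hci.intervalIntegrable _ _),
      ← intervalIntegral.integral_const_mul]
    refine intervalIntegral.integral_mono_on hφ.2.le (hcd.intervalIntegrable _ _)
      ((hci.const_mul _).intervalIntegrable _ _) fun θ hθ => ?_
    have hd := delta_pos h0.le h1 θ
    have hle := hanti.antitoneOn ⟨hφ.1.le, hφ.2.le⟩ ⟨hφ.1.le.trans hθ.1, hθ.2⟩ hθ.1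
    rw [← delta, mul_one_div, le_div_iff₀ hd]
    nlinarith
  nlinarith [mul_lt_mul_of_pos_right hlow (sub_pos.2 hFK), mul_le_mul_of_nonneg_right hhigh hF.le]

/-- The difference vanishes at 0 and has derivative k'² tan²x / Δ(x) ≥ 0. -/
theorem ellEinc_le_tan_mul_delta (h0 : 0 ≤ k) (h1 : k < 1) {φ : ℝ} (hφ : 0 ≤ φ)
    (hφ' : φ < π / 2) : ellEinc k φ ≤ tan φ * delta k φ := by
  have hderiv : ∀ x ∈ Icc 0 φ, HasDerivAt (fun x => tan x * delta k x - ellEinc k x)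
      (sin x ^ 2 * (1 - k ^ 2) / (cos x ^ 2 * delta k x)) x := fun x hx => by
    have hc := cos_pos_of_mem_Icc hφ' hx
    refine (((hasDerivAt_tan hc.ne').mul (hasDerivAt_delta h0 h1 x)).sub
      (hasDerivAt_ellEinc x)).congr_deriv ?_
    have hd := (delta_pos h0 h1 x).ne'
    have hΔ2 := delta_sq h0 h1 x
    have hc2 := cos_sq' x
    rw [tan_eq_sin_div_cos]
    field_simp
    rw [hΔ2, hc2]
    ring
  have hmono : MonotoneOn (fun x => tan x * delta k x - ellEinc k x) (Icc 0 φ) := by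
    refine monotoneOn_of_deriv_nonneg (convex_Icc _ _)
      (fun x hx => (hderiv x hx).continuousAt.continuousWithinAt)
      (fun x hx => (hderiv x (interior_subset hx)).differentiableAt.differentiableWithinAt)
      fun x hx => ?_
    rw [(hderiv x (interior_subset hx)).deriv]
    have hd := delta_pos h0 h1 x
    have : 0 ≤ 1 - k ^ 2 := by nlinarith
    positivity
  have := hmono ⟨le_rfl, hφ⟩ ⟨hφ, le_rfl⟩ hφ
  simp only [tan_zero, zero_mul, ellEinc_zero] at this
  linarith

theorem ellE_pos (h0 : 0 ≤ k) (h1 : k < 1) : 0 < ellE k :=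
  intervalIntegral.intervalIntegral_pos_of_pos (continuous_delta.intervalIntegrable _ _)
    (fun θ => delta_pos h0 h1 θ) (by positivity)

variable {lam : ℝ}

theorem zeta_pos (h0 : 0 < k) (h1 : k < 1) (hl0 : 0 < lam) (hl1 : lam < 1 / 2) :
    0 < zeta lam k := by
  have h := ellE_mul_ellF_lt h0 h1 (ampl_mem h0.le h1 hl0 hl1)
  rw [ellF_ampl h0.le h1] at h
  have hK := ellK_pos h0.le h1
  unfold zeta
  nlinarith

theorem cos_mul_zeta_lt (h0 : 0 < k) (h1 : k < 1) (hl0 : 0 < lam) (hl1 : lam < 1 / 2) :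
    cos (ampl lam k) * zeta lam k < sin (ampl lam k) * delta k (ampl lam k) := by
  have hmem := ampl_mem h0.le h1 hl0 hl1
  have h := ellEinc_le_tan_mul_delta h0.le h1 hmem.1.le hmem.2
  have hc : 0 < cos (ampl lam k) := cos_pos_of_mem_Ioo ⟨by linarith [hmem.1, pi_pos], hmem.2⟩
  have hE := mul_pos hl0 (ellE_pos h0.le h1)
  rw [tan_eq_sin_div_cos, div_mul_eq_mul_div, le_div_iff₀ hc] at h
  unfold zeta
  nlinarith

theorem strictMonoOn_zStar (hl0 : 0 < lam) (hl1 : lam < 1 / 2) :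
    StrictMonoOn (zStar lam) (Ioo 0 1) := by
  refine strictMonoOn_of_deriv_pos (convex_Ioo _ _) (fun k hk =>
    (hasDerivAt_zStar hk.1 hk.2 hl0 hl1).continuousAt.continuousWithinAt) fun k hk => ?_
  rw [interior_Ioo] at hk
  obtain ⟨h0, h1⟩ := hk
  rw [(hasDerivAt_zStar h0 h1 hl0 hl1).deriv]
  have hd := delta_pos h0.le h1 (ampl lam k)
  have hk : 0 < 1 - k ^ 2 := by nlinarith
  exact div_pos (mul_pos (zeta_pos h0 h1 hl0 hl1) (sub_pos.2 (cos_mul_zeta_lt h0 h1 hl0 hl1)))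
    (by positivity)

end Monotone

/-- The complementary modulus `k' = √(1 - k²)`. -/
noncomputable def comod (k : ℝ) : ℝ := √(1 - k ^ 2)

/-! ### Elementary bounds from k' ≤ Δ ≤ 1 -/

section Comod

variable {k : ℝ}

theorem comod_pos (h0 : 0 ≤ k) (h1 : k < 1) : 0 < comod k :=
  Real.sqrt_pos.2 (by nlinarith)

theorem comod_sq (h0 : 0 ≤ k) (h1 : k < 1) : comod k ^ 2 = 1 - k ^ 2 :=
  Real.sq_sqrt (by nlinarith)

theorem comod_le_delta (k θ : ℝ) : comod k ≤ delta k θ := by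
  refine Real.sqrt_le_sqrt ?_
  nlinarith [sin_sq_le_one θ, sq_nonneg k]

theorem le_ellF (h0 : 0 ≤ k) (h1 : k < 1) {φ : ℝ} (hφ : 0 ≤ φ) : φ ≤ ellF k φ := by
  simpa [ellF_zero] using sub_le_ellF_sub h0 h1 hφ

theorem comod_mul_ellF_le (h0 : 0 ≤ k) (h1 : k < 1) {φ : ℝ} (hφ : 0 ≤ φ) :
    comod k * ellF k φ ≤ φ := by
  have h := intervalIntegral.integral_mono_on (μ := volume) hφ
    ((continuous_integrand h0 h1).intervalIntegrable 0 φ)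
    (intervalIntegrable_const (c := 1 / comod k)) fun θ _ =>
      one_div_le_one_div_of_le (comod_pos h0 h1) (comod_le_delta k θ)
  have hk := comod_pos h0 h1
  rw [intervalIntegral.integral_const, sub_zero, smul_eq_mul, mul_one_div, ← ellF,
    le_div_iff₀ hk] at h
  linarith

theorem ellEinc_le (k : ℝ) {φ : ℝ} (hφ : 0 ≤ φ) : ellEinc k φ ≤ φ := by
  have h := intervalIntegral.integral_mono_on (μ := volume) hφ
    ((continuous_delta (k := k)).intervalIntegrable 0 φ)
    (intervalIntegrable_const (c := (1 : ℝ))) fun θ _ => delta_le_one k θ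
  simpa [ellEinc, delta] using h

theorem comod_mul_le_ellEinc (k : ℝ) {φ : ℝ} (hφ : 0 ≤ φ) : comod k * φ ≤ ellEinc k φ := by
  have h := intervalIntegral.integral_mono_on (μ := volume) hφ
    (intervalIntegrable_const (c := comod k))
    ((continuous_delta (k := k)).intervalIntegrable 0 φ) fun θ _ => comod_le_delta k θ
  rw [intervalIntegral.integral_const, sub_zero, smul_eq_mul] at h
  rw [mul_comm]
  exact h

end Comod

/-! ### The limit k → 0 -/

section LimitZero

variable {lam : ℝ}

theorem eventually_mem_nhdsGT_zero : ∀ᶠ k : ℝ in 𝓝[>] 0, k ∈ Ioo (0 : ℝ) 1 :=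
  Ioo_mem_nhdsGT one_pos

theorem tendsto_comod_zero : Tendsto comod (𝓝[>] 0) (𝓝 1) := by
  have h : Continuous comod := by unfold comod; fun_prop
  have := h.tendsto 0
  simp only [comod, ne_eq, OfNat.ofNat_ne_zero, not_false_eq_true, zero_pow, sub_zero,
    Real.sqrt_one] at this
  exact this.mono_left nhdsWithin_le_nhds

/-- From k'F(α) ≤ α ≤ F(α) = 2λK and π/2 ≤ K ≤ π/(2k'). -/
theorem tendsto_ampl_zero (hl0 : 0 < lam) (hl1 : lam < 1 / 2) :
    Tendsto (ampl lam) (𝓝[>] 0) (𝓝 (lam * π)) := by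
  have hc := tendsto_comod_zero
  refine tendsto_of_tendsto_of_tendsto_of_le_of_le' (g := fun k => comod k * (lam * π))
    (h := fun k => lam * π / comod k) ?_ ?_ ?_ ?_
  · simpa using hc.mul_const (lam * π)
  · simpa using! (tendsto_const_nhds (x := lam * π)).div hc one_ne_zero
  · filter_upwards [eventually_mem_nhdsGT_zero] with k ⟨h0, h1⟩
    have hφ := (ampl_mem h0.le h1 hl0 hl1).1.le
    have h := comod_mul_ellF_le h0.le h1 hφ
    rw [ellF_ampl h0.le h1] at h
    refine le_trans ?_ h
    have hK : π / 2 ≤ ellK k := le_ellF h0.le h1 (by positivity)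
    have := comod_pos h0.le h1
    have : lam * π ≤ 2 * lam * ellK k := by nlinarith
    gcongr
  · filter_upwards [eventually_mem_nhdsGT_zero] with k ⟨h0, h1⟩
    have hφ := (ampl_mem h0.le h1 hl0 hl1).1.le
    have h := le_ellF h0.le h1 hφ
    rw [ellF_ampl h0.le h1] at h
    have hK : comod k * ellK k ≤ π / 2 := comod_mul_ellF_le h0.le h1 (by positivity)
    rw [le_div_iff₀ (comod_pos h0.le h1)]
    have := comod_pos h0.le h1
    nlinarith

theorem tendsto_ellE_zero : Tendsto ellE (𝓝[>] 0) (𝓝 (π / 2)) := by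
  refine tendsto_of_tendsto_of_tendsto_of_le_of_le (g := fun k => comod k * (π / 2))
    (h := fun _ => π / 2) ?_ tendsto_const_nhds (fun k => comod_mul_le_ellEinc k (by positivity))
    fun k => ellEinc_le k (by positivity)
  simpa using tendsto_comod_zero.mul_const (π / 2)

theorem tendsto_zeta_zero (hl0 : 0 < lam) (hl1 : lam < 1 / 2) :
    Tendsto (zeta lam) (𝓝[>] 0) (𝓝 0) := by
  have ha := tendsto_ampl_zero hl0 hl1
  have h : Tendsto (fun k => ellEinc k (ampl lam k)) (𝓝[>] 0) (𝓝 (lam * π)) := by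
    refine tendsto_of_tendsto_of_tendsto_of_le_of_le' (g := fun k => comod k * ampl lam k)
      (h := ampl lam) ?_ ha ?_ ?_
    · simpa using tendsto_comod_zero.mul ha
    · filter_upwards [eventually_mem_nhdsGT_zero] with k ⟨h0, h1⟩
      exact comod_mul_le_ellEinc k (ampl_mem h0.le h1 hl0 hl1).1.le
    · filter_upwards [eventually_mem_nhdsGT_zero] with k ⟨h0, h1⟩
      exact ellEinc_le k (ampl_mem h0.le h1 hl0 hl1).1.le
  have := h.sub (tendsto_ellE_zero.const_mul (2 * lam))
  rwa [show lam * π - 2 * lam * (π / 2) = 0 by ring] at this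

theorem tendsto_zStar_zero (hl0 : 0 < lam) (hl1 : lam < 1 / 2) :
    Tendsto (zStar lam) (𝓝[>] 0) (𝓝 (cos (lam * π))) := by
  have ha := tendsto_ampl_zero hl0 hl1
  have hd : Tendsto (fun k => delta k (ampl lam k)) (𝓝[>] 0) (𝓝 1) :=
    tendsto_of_tendsto_of_tendsto_of_le_of_le tendsto_comod_zero tendsto_const_nhds
      (fun k => comod_le_delta k _) fun k => delta_le_one k _
  have h := ((continuous_cos.tendsto _).comp ha).add
    ((((continuous_sin.tendsto _).comp ha).mul (tendsto_zeta_zero hl0 hl1)).div hd one_ne_zero)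
  rw [mul_zero, zero_div, add_zero] at h
  refine h.congr' ?_
  filter_upwards [eventually_mem_nhdsGT_zero] with k ⟨h0, h1⟩
  exact (zStar_eq_ampl h0.le h1 hl0 hl1).symm

end LimitZero

/-! ### Comparison of F with arsinh(tan φ), and the reflection u ↦ K - u -/

section Comparison

variable {k : ℝ}

theorem delta_sq_eq (h0 : 0 ≤ k) (h1 : k < 1) (θ : ℝ) :
    delta k θ ^ 2 = cos θ ^ 2 + comod k ^ 2 * sin θ ^ 2 := by
  rw [delta_sq h0 h1, comod_sq h0 h1, cos_sq']
  ring

theorem cos_le_delta (h0 : 0 ≤ k) (h1 : k < 1) (θ : ℝ) : cos θ ≤ delta k θ := by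
  refine le_of_sq_le_sq ?_ (delta_pos h0 h1 θ).le
  rw [delta_sq_eq h0 h1]
  nlinarith [mul_nonneg (sq_nonneg (comod k)) (sq_nonneg (sin θ))]

theorem hasDerivAt_arsinh_tan {θ : ℝ} (hc : 0 < cos θ) :
    HasDerivAt (fun θ => arsinh (tan θ)) (1 / cos θ) θ := by
  refine ((hasDerivAt_arsinh (tan θ)).comp θ (hasDerivAt_tan hc.ne')).congr_deriv ?_
  have h : 1 + tan θ ^ 2 = (1 / cos θ) ^ 2 := by
    rw [tan_eq_sin_div_cos]
    field_simp
    exact cos_sq_add_sin_sq θ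
  rw [h, Real.sqrt_sq (by positivity)]
  field_simp

theorem ellF_le_arsinh_tan (h0 : 0 ≤ k) (h1 : k < 1) {φ : ℝ} (hφ : 0 ≤ φ) (hφ' : φ < π / 2) :
    ellF k φ ≤ arsinh (tan φ) := by
  have hderiv : ∀ x ∈ Icc 0 φ, HasDerivAt (fun x => arsinh (tan x) - ellF k x)
      (1 / cos x - 1 / delta k x) x := fun x hx =>
    (hasDerivAt_arsinh_tan (cos_pos_of_mem_Icc hφ' hx)).sub (hasDerivAt_ellF h0 h1 x)
  have hmono : MonotoneOn (fun x => arsinh (tan x) - ellF k x) (Icc 0 φ) := by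
    refine monotoneOn_of_deriv_nonneg (convex_Icc _ _)
      (fun x hx => (hderiv x hx).continuousAt.continuousWithinAt)
      (fun x hx => (hderiv x (interior_subset hx)).differentiableAt.differentiableWithinAt)
      fun x hx => ?_
    rw [(hderiv x (interior_subset hx)).deriv]
    exact sub_nonneg.2 (one_div_le_one_div_of_le
      (cos_pos_of_mem_Icc hφ' (interior_subset hx)) (cos_le_delta h0 h1 x))
  have := hmono ⟨le_rfl, hφ⟩ ⟨hφ, le_rfl⟩ hφ
  simp only [tan_zero, arsinh_zero, ellF_zero] at this
  linarith

/-- Δ(x) = cos x √(1 + k'² tan²x), and on [0, φ] the root is at most its value at φ. -/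
theorem arsinh_tan_le (h0 : 0 ≤ k) (h1 : k < 1) {φ : ℝ} (hφ : 0 ≤ φ) (hφ' : φ < π / 2) :
    arsinh (tan φ) ≤ √(1 + comod k ^ 2 * tan φ ^ 2) * ellF k φ := by
  set R := √(1 + comod k ^ 2 * tan φ ^ 2) with hR
  have hR2 : R ^ 2 = 1 + comod k ^ 2 * tan φ ^ 2 := Real.sq_sqrt (by positivity)
  have hR0 : 0 < R := Real.sqrt_pos.2 (by positivity)
  have hderiv : ∀ x ∈ Icc 0 φ, HasDerivAt (fun x => R * ellF k x - arsinh (tan x))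
      (R * (1 / delta k x) - 1 / cos x) x := fun x hx =>
    ((hasDerivAt_ellF h0 h1 x).const_mul R).sub
      (hasDerivAt_arsinh_tan (cos_pos_of_mem_Icc hφ' hx))
  have hmono : MonotoneOn (fun x => R * ellF k x - arsinh (tan x)) (Icc 0 φ) := by
    refine monotoneOn_of_deriv_nonneg (convex_Icc _ _)
      (fun x hx => (hderiv x hx).continuousAt.continuousWithinAt)
      (fun x hx => (hderiv x (interior_subset hx)).differentiableAt.differentiableWithinAt)
      fun x hx => ?_
    have hx := interior_subset hx
    rw [(hderiv x hx).deriv]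
    have hc := cos_pos_of_mem_Icc hφ' hx
    have hd := delta_pos h0 h1 x
    have htan : tan x ^ 2 ≤ tan φ ^ 2 := by
      have h0x : 0 ≤ tan x := tan_nonneg_of_nonneg_of_le_pi_div_two hx.1 (hx.2.trans hφ'.le)
      have : tan x ≤ tan φ := strictMonoOn_tan.monotoneOn
        ⟨by linarith [hx.1, pi_pos], hx.2.trans_lt hφ'⟩ ⟨by linarith [pi_pos], hφ'⟩ hx.2
      gcongr
    have hle : delta k x ≤ R * cos x := by
      refine le_of_sq_le_sq ?_ (by positivity)
      have hs : sin x ^ 2 = tan x ^ 2 * cos x ^ 2 := by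
        rw [tan_eq_sin_div_cos]; field_simp
      rw [delta_sq_eq h0 h1, mul_pow, hR2, hs]
      have := mul_le_mul_of_nonneg_left htan (mul_nonneg (sq_nonneg (comod k)) (sq_nonneg (cos x)))
      nlinarith
    rw [sub_nonneg, mul_one_div, div_le_div_iff₀ hc hd]
    linarith
  have := hmono ⟨le_rfl, hφ⟩ ⟨hφ, le_rfl⟩ hφ
  simp only [tan_zero, arsinh_zero, ellF_zero] at this
  linarith

/-- Here χ = π/2 - arctan(k' tan φ) is am(K - u) for φ = am u. The sum is constant because Δ(χ) =
k'/Δ(φ). -/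
theorem ellF_add_ellF_eq_ellK (h0 : 0 ≤ k) (h1 : k < 1) {φ : ℝ} (hφ : 0 ≤ φ) (hφ' : φ < π / 2) :
    ellF k φ + ellF k (π / 2 - arctan (comod k * tan φ)) = ellK k := by
  have hkp := comod_pos h0 h1
  refine eq_of_hasDerivAt_eq
    (f := fun φ => ellF k φ + ellF k (π / 2 - arctan (comod k * tan φ))) (g := fun _ => ellK k)
    (d := fun _ => 0) hφ (by simp [ellF_zero, ellF_pi_div_two]) (fun x hx => ?_)
    fun x _ => hasDerivAt_const x _
  have hc := cos_pos_of_mem_Icc hφ' hx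
  have hd := delta_pos h0 h1 x
  have hT : 1 + (comod k * tan x) ^ 2 = delta k x ^ 2 / cos x ^ 2 := by
    rw [delta_sq_eq h0 h1, tan_eq_sin_div_cos]
    field_simp
  have hχ : delta k (π / 2 - arctan (comod k * tan x)) = comod k / delta k x := by
    rw [delta, Real.sqrt_eq_iff_eq_sq (radicand_pos h0 h1 _).le (by positivity),
      sin_pi_div_two_sub, cos_sq_arctan, hT]
    have hk2 : k ^ 2 = 1 - comod k ^ 2 := by rw [comod_sq h0 h1]; ring
    have hΔ2 := delta_sq_eq h0 h1 x
    field_simp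
    rw [hΔ2, hk2, sin_sq]
    ring
  have h := (hasDerivAt_ellF h0 h1 x).add ((hasDerivAt_ellF h0 h1 _).comp x
    ((((hasDerivAt_tan hc.ne').const_mul (comod k)).arctan).const_sub (π / 2)))
  refine h.congr_deriv ?_
  rw [hχ, hT]
  field_simp
  ring

/-- The fixed point of the reflection satisfies k' tan²φ = 1, so it is am(K/2). -/
theorem ellF_arctan_inv_sqrt (h0 : 0 ≤ k) (h1 : k < 1) :
    2 * ellF k (arctan (√(comod k))⁻¹) = ellK k := by
  have hkp := comod_pos h0 h1
  have hs := Real.sqrt_pos.2 hkp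
  have hs2 := Real.sq_sqrt hkp.le
  have h := ellF_add_ellF_eq_ellK h0 h1 (φ := arctan (√(comod k))⁻¹)
    (arctan_nonneg.2 (by positivity)) (arctan_lt_pi_div_two _)
  have he : comod k * (√(comod k))⁻¹ = √(comod k) := by
    field_simp
    exact hs2.symm
  rw [tan_arctan, he, ← arctan_inv_of_pos hs] at h
  linarith

end Comparison

/-! ### The asymptotics as k → 1 -/

section LimitOne

variable {lam : ℝ}

/-- The tangent of `am(λK)` as a function of the modulus. -/
noncomputable def halfTan (lam k : ℝ) : ℝ := tan (am k (lam * ellK k))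

theorem halfTan_pos {k : ℝ} (h0 : 0 ≤ k) (h1 : k < 1) (hl0 : 0 < lam) (hl1 : lam < 1) :
    0 < halfTan lam k :=
  tan_pos_of_pos_of_lt_pi_div_two (am_mul_ellK_mem h0 h1 hl0 hl1).1
    (am_mul_ellK_mem h0 h1 hl0 hl1).2

theorem comod_mul_sq_halfTan_le {k : ℝ} (h0 : 0 ≤ k) (h1 : k < 1) (hl0 : 0 < lam)
    (hl1 : lam < 1 / 2) : comod k * halfTan lam k ^ 2 ≤ 1 := by
  have hT := halfTan_pos h0 h1 hl0 (by linarith : lam < 1)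
  have hK := ellK_pos h0 h1
  have hmem := am_mul_ellK_mem h0 h1 hl0 (by linarith : lam < 1)
  have hkp := comod_pos h0 h1
  have hs := Real.sqrt_pos.2 hkp
  have hle : am k (lam * ellK k) < arctan (√(comod k))⁻¹ := by
    rw [← (ellF_strictMono h0 h1).lt_iff_lt, ellF_am h0 h1]
    nlinarith [ellF_arctan_inv_sqrt h0 h1]
  have hlt : halfTan lam k < (√(comod k))⁻¹ := by
    have := strictMonoOn_tan ⟨by linarith [hmem.1, pi_pos], hmem.2⟩ (arctan_mem_Ioo _) hle
    rwa [tan_arctan] at this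
  have h2 : halfTan lam k ^ 2 ≤ ((√(comod k))⁻¹) ^ 2 := by gcongr
  rw [inv_pow, Real.sq_sqrt hkp.le] at h2
  calc comod k * halfTan lam k ^ 2 ≤ comod k * (comod k)⁻¹ := by gcongr
    _ = 1 := mul_inv_cancel₀ hkp.ne'

/-- Duplication written in T and k'. Once k'T² → 0, the numerator tends to 1 and 2T² dominates the
denominator. -/
theorem delta_ampl_eq {k : ℝ} (h0 : 0 ≤ k) (h1 : k < 1) (hl0 : 0 < lam) (hl1 : lam < 1 / 2) :
    delta k (ampl lam k) =
      (1 + 2 * comod k ^ 2 * halfTan lam k ^ 2 + (comod k * halfTan lam k ^ 2) ^ 2) /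
        (1 + 2 * halfTan lam k ^ 2 + (comod k * halfTan lam k ^ 2) ^ 2) := by
  have hmem := am_mul_ellK_mem h0 h1 hl0 (by linarith : lam < 1)
  have hc := cos_pos_of_mem_Ioo ⟨by linarith [hmem.1, pi_pos], hmem.2⟩
  rw [ampl, am_two_mul_mul_ellK h0 h1 hl0 (by linarith), delta_dbl h0 h1 hc, halfTan]
  generalize am k (lam * ellK k) = φ at *
  have hD := (one_sub_sin_pow_four_pos h0 h1 φ).ne'
  have hs : sin φ ^ 2 = tan φ ^ 2 * cos φ ^ 2 := by
    rw [tan_eq_sin_div_cos]; field_simp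
  have hcc : cos φ ^ 2 = 1 / (1 + tan φ ^ 2) := by
    rw [← inv_one_add_tan_sq hc.ne', one_div]
  have hs4 : sin φ ^ 4 = (tan φ ^ 2 / (1 + tan φ ^ 2)) ^ 2 := by
    rw [show sin φ ^ 4 = (sin φ ^ 2) ^ 2 by ring, hs, hcc, mul_one_div]
  have hk2 : k ^ 2 = 1 - comod k ^ 2 := by rw [comod_sq h0 h1]; ring
  have hpos : 0 < 1 + 2 * tan φ ^ 2 + (comod k * tan φ ^ 2) ^ 2 := by positivity
  have hT : 0 < 1 + tan φ ^ 2 := by positivity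
  rw [div_eq_div_iff hD hpos.ne', delta_sq h0 h1, hs4, hs, hcc, hk2]
  field_simp
  ring

theorem eventually_mem_nhdsLT_one : ∀ᶠ k : ℝ in 𝓝[<] 1, k ∈ Ioo (0 : ℝ) 1 :=
  Ioo_mem_nhdsLT one_pos

theorem tendsto_comod_one : Tendsto comod (𝓝[<] 1) (𝓝[>] 0) := by
  refine tendsto_nhdsWithin_iff.2 ⟨?_, ?_⟩
  · have h : Continuous comod := by unfold comod; fun_prop
    have := h.tendsto 1
    simp only [comod, one_pow, sub_self, Real.sqrt_zero] at this
    exact this.mono_left nhdsWithin_le_nhds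
  · filter_upwards [eventually_mem_nhdsLT_one] with k hk
    exact comod_pos hk.1.le hk.2

/-- `2 arsinh (1 / √x) - log (4 / x) → 0` as `x → 0+`. -/
theorem tendsto_arsinh_inv_sqrt :
    Tendsto (fun x : ℝ => 2 * arsinh (√x)⁻¹ - log (4 / x)) (𝓝[>] 0) (𝓝 0) := by
  -- For x > 0 this is exactly the difference in question, by the logarithmic form of arsinh.
  have h : Tendsto (fun x : ℝ => 2 * log ((1 + √(1 + x)) / 2)) (𝓝[>] 0) (𝓝 0) := by
    have hc : ContinuousAt (fun x : ℝ => 2 * log ((1 + √(1 + x)) / 2)) 0 := by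
      refine continuousAt_const.mul (ContinuousAt.log (by fun_prop) ?_)
      positivity
    have := hc.tendsto
    norm_num at this
    exact this.mono_left nhdsWithin_le_nhds
  refine h.congr' ?_
  filter_upwards [self_mem_nhdsWithin] with x hx
  have hx : 0 < x := hx
  have hs := Real.sqrt_pos.2 hx
  have hs2 := Real.sq_sqrt hx.le
  have he : (√x)⁻¹ + √(1 + (√x)⁻¹ ^ 2) = (1 + √(1 + x)) / √x := by
    rw [inv_pow, hs2, show 1 + x⁻¹ = (1 + x) / x by field_simp; ring,
      Real.sqrt_div (by positivity)]
    ring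
  rw [arsinh, he, log_div (by positivity) (by positivity), log_div (by positivity) (by positivity),
    log_div (by positivity) (by positivity), Real.log_sqrt hx.le,
    show (4 : ℝ) = 2 ^ 2 by norm_num, Real.log_pow]
  push_cast
  ring

theorem tendsto_mul_log_four_div : Tendsto (fun x : ℝ => x * log (4 / x)) (𝓝[>] 0) (𝓝 0) := by
  have h1 : Tendsto (fun x : ℝ => x * log 4) (𝓝[>] 0) (𝓝 0) := by
    have : Tendsto (fun x : ℝ => x * log 4) (𝓝 0) (𝓝 (0 * log 4)) :=
      tendsto_id.mul_const _
    rw [zero_mul] at this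
    exact this.mono_left nhdsWithin_le_nhds
  have h2 : Tendsto (fun x : ℝ => x * log x) (𝓝[>] 0) (𝓝 0) := by
    have := Real.continuous_mul_log.tendsto 0
    rw [zero_mul] at this
    exact this.mono_left nhdsWithin_le_nhds
  have := h1.sub h2
  rw [sub_zero] at this
  refine this.congr' ?_
  filter_upwards [self_mem_nhdsWithin] with x hx
  rw [log_div (by norm_num) (ne_of_gt hx)]
  ring

/-- `log (4 / k')`, the leading part of `K(k)` as `k → 1`. -/
noncomputable def logComod (k : ℝ) : ℝ := log (4 / comod k)

/-- Bounds the factor in `arsinh_tan_le` for y = tan²φ: k'²y ≤ k', and √(1 + k') ≤ 1 + k'. -/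
theorem sqrt_one_add_le {k y : ℝ} (h0 : 0 ≤ k) (h1 : k < 1) (hy : comod k * y ≤ 1) :
    √(1 + comod k ^ 2 * y) ≤ 1 + comod k := by
  have hkp := comod_pos h0 h1
  refine Real.sqrt_le_iff.2 ⟨by positivity, ?_⟩
  nlinarith

theorem ellK_bounds {k : ℝ} (h0 : 0 ≤ k) (h1 : k < 1) :
    ellK k ≤ 2 * arsinh (√(comod k))⁻¹ ∧
      2 * arsinh (√(comod k))⁻¹ ≤ (1 + comod k) * ellK k := by
  have hkp := comod_pos h0 h1
  have hF := ellF_arctan_inv_sqrt h0 h1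
  have h0' : 0 ≤ arctan (√(comod k))⁻¹ := arctan_nonneg.2 (by positivity)
  have hu := ellF_le_arsinh_tan h0 h1 h0' (arctan_lt_pi_div_two _)
  have hl := arsinh_tan_le h0 h1 h0' (arctan_lt_pi_div_two _)
  rw [tan_arctan] at hu hl
  have hs := sqrt_one_add_le h0 h1 (y := (√(comod k))⁻¹ ^ 2) (by
    rw [inv_pow, Real.sq_sqrt hkp.le, mul_inv_cancel₀ hkp.ne'])
  have hK := ellK_pos h0 h1
  refine ⟨by linarith, ?_⟩
  have : √(1 + comod k ^ 2 * (√(comod k))⁻¹ ^ 2) * ellF k (arctan (√(comod k))⁻¹) ≤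
      (1 + comod k) * ellF k (arctan (√(comod k))⁻¹) :=
    mul_le_mul_of_nonneg_right hs (by linarith)
  nlinarith

theorem tendsto_comod_mul_ellK : Tendsto (fun k => comod k * ellK k) (𝓝[<] 1) (𝓝 0) := by
  have h1 := tendsto_comod_one.mono_right nhdsWithin_le_nhds
  have h : Tendsto (fun k => comod k * (2 * arsinh (√(comod k))⁻¹)) (𝓝[<] 1) (𝓝 0) := by
    have := (h1.mul (tendsto_arsinh_inv_sqrt.comp tendsto_comod_one)).add
      (tendsto_mul_log_four_div.comp tendsto_comod_one)
    simp only [mul_zero, add_zero] at this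
    refine this.congr fun k => ?_
    simp only [Function.comp]
    ring
  refine squeeze_zero' ?_ ?_ h
  · filter_upwards [eventually_mem_nhdsLT_one] with k ⟨h0, h1⟩
    exact (mul_pos (comod_pos h0.le h1) (ellK_pos h0.le h1)).le
  · filter_upwards [eventually_mem_nhdsLT_one] with k ⟨h0, h1⟩
    exact mul_le_mul_of_nonneg_left (ellK_bounds h0.le h1).1 (comod_pos h0.le h1).le

theorem tendsto_ellK_sub_logComod :
    Tendsto (fun k => ellK k - logComod k) (𝓝[<] 1) (𝓝 0) := by
  have h := tendsto_arsinh_inv_sqrt.comp tendsto_comod_one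
  have h' := h.sub tendsto_comod_mul_ellK
  rw [sub_zero] at h'
  refine tendsto_of_tendsto_of_tendsto_of_le_of_le' h' h ?_ ?_
  · filter_upwards [eventually_mem_nhdsLT_one] with k ⟨h0, h1⟩
    have := (ellK_bounds h0.le h1).2
    simp only [Function.comp, logComod]
    linarith
  · filter_upwards [eventually_mem_nhdsLT_one] with k ⟨h0, h1⟩
    have := (ellK_bounds h0.le h1).1
    simp only [Function.comp, logComod]
    linarith

theorem tendsto_logComod : Tendsto logComod (𝓝[<] 1) atTop := by
  refine tendsto_log_atTop.comp ?_
  have := (tendsto_inv_nhdsGT_zero.comp tendsto_comod_one).const_mul_atTop (four_pos (α := ℝ))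
  exact this.congr fun k => by simp [div_eq_mul_inv]

/-- The comparison gives 0 ≤ arsinh T - λK ≤ k'λK, and k'K → 0. -/
theorem tendsto_arsinh_halfTan_sub (hl0 : 0 < lam) (hl1 : lam < 1 / 2) :
    Tendsto (fun k => arsinh (halfTan lam k) - lam * logComod k) (𝓝[<] 1) (𝓝 0) := by
  have h1 : Tendsto (fun k => arsinh (halfTan lam k) - lam * ellK k) (𝓝[<] 1) (𝓝 0) := by
    have hlim := tendsto_comod_mul_ellK.const_mul lam
    rw [mul_zero] at hlim
    refine squeeze_zero' ?_ ?_ hlim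
    · filter_upwards [eventually_mem_nhdsLT_one] with k ⟨h0, h1⟩
      have hmem := am_mul_ellK_mem h0.le h1 hl0 (by linarith : lam < 1)
      have := ellF_le_arsinh_tan h0.le h1 hmem.1.le hmem.2
      rw [ellF_am h0.le h1] at this
      exact sub_nonneg.2 this
    · filter_upwards [eventually_mem_nhdsLT_one] with k ⟨h0, h1⟩
      have hmem := am_mul_ellK_mem h0.le h1 hl0 (by linarith : lam < 1)
      have := arsinh_tan_le h0.le h1 hmem.1.le hmem.2
      rw [ellF_am h0.le h1] at this
      have hs := sqrt_one_add_le h0.le h1 (comod_mul_sq_halfTan_le h0.le h1 hl0 hl1)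
      have hK := mul_pos hl0 (ellK_pos h0.le h1)
      have := this.trans (mul_le_mul_of_nonneg_right hs hK.le)
      change arsinh (halfTan lam k) ≤ _ at this
      linarith
  have := h1.add (tendsto_ellK_sub_logComod.const_mul lam)
  rw [mul_zero, add_zero] at this
  exact this.congr fun k => by ring

theorem tendsto_sq_halfTan_mul_exp (hl0 : 0 < lam) (hl1 : lam < 1 / 2) :
    Tendsto (fun k => halfTan lam k ^ 2 * exp (-(2 * lam * logComod k))) (𝓝[<] 1)
      (𝓝 (1 / 4)) := by
  have h := tendsto_arsinh_halfTan_sub hl0 hl1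
  have hL := tendsto_logComod.const_mul_atTop (by linarith : 0 < 2 * lam)
  have h1 := (continuous_exp.tendsto _).comp h
  -- With a = arsinh T the exponent is -a - λL. Then T e^{-λL} = (e^{a - λL} - e^{-a - λL})/2 tends
  -- to 1/2.
  have h2 := tendsto_exp_atBot.comp ((tendsto_neg_atTop_atBot.comp hL).atBot_add h.neg)
  have h3 := ((h1.sub h2).pow 2).div_const 4
  rw [exp_zero, sub_zero, one_pow] at h3
  refine h3.congr fun k => ?_
  simp only [Function.comp]
  set a := arsinh (halfTan lam k) with ha
  have hT : halfTan lam k = (exp a - exp (-a)) / 2 := by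
    rw [← Real.sinh_eq, ha, sinh_arsinh]
  rw [hT, show -(2 * lam * logComod k) + -(a - lam * logComod k) = -a + -(lam * logComod k) by ring,
    show -(2 * lam * logComod k) = -(lam * logComod k) + -(lam * logComod k) by ring,
    show a - lam * logComod k = a + -(lam * logComod k) by ring, exp_add, exp_add, exp_add]
  ring

/-- As k' = 4e^{-L}, the product is 4 (T² e^{-2λL}) e^{-(1 - 2λ)L}, and 2λ < 1. -/
theorem tendsto_comod_mul_sq_halfTan (hl0 : 0 < lam) (hl1 : lam < 1 / 2) :
    Tendsto (fun k => comod k * halfTan lam k ^ 2) (𝓝[<] 1) (𝓝 0) := by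
  have hL := tendsto_logComod.const_mul_atTop (by linarith : 0 < 1 - 2 * lam)
  have h := (tendsto_sq_halfTan_mul_exp hl0 hl1).mul
    ((tendsto_exp_atBot.comp (tendsto_neg_atTop_atBot.comp hL)).const_mul 4)
  rw [mul_zero, mul_zero] at h
  refine h.congr' ?_
  filter_upwards [eventually_mem_nhdsLT_one] with k ⟨h0, h1⟩
  have hkp := comod_pos h0.le h1
  have he : exp (-(2 * lam * logComod k)) * exp (-((1 - 2 * lam) * logComod k)) =
      comod k / 4 := by
    rw [← exp_add, show -(2 * lam * logComod k) + -((1 - 2 * lam) * logComod k) = -logComod k by ring,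
      exp_neg, logComod, exp_log (by positivity), inv_div]
  simp only [Function.comp]
  linear_combination 4 * halfTan lam k ^ 2 * he

theorem tendsto_exp_div_delta_ampl (hl0 : 0 < lam) (hl1 : lam < 1 / 2) :
    Tendsto (fun k => exp (-(2 * lam * logComod k)) / delta k (ampl lam k)) (𝓝[<] 1)
      (𝓝 (1 / 2)) := by
  have hc := tendsto_comod_one.mono_right nhdsWithin_le_nhds
  have hL := tendsto_logComod.const_mul_atTop (by linarith : 0 < 2 * lam)
  have he := tendsto_exp_atBot.comp (tendsto_neg_atTop_atBot.comp hL)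
  have hT := tendsto_sq_halfTan_mul_exp hl0 hl1
  have hcT := tendsto_comod_mul_sq_halfTan hl0 hl1
  have hnum := (he.add (hT.const_mul 2)).add ((hcT.pow 2).mul he)
  have hden := ((tendsto_const_nhds (x := (1 : ℝ))).add ((hc.mul hcT).const_mul 2)).add (hcT.pow 2)
  have h := hnum.div hden (by norm_num)
  norm_num at h
  refine h.congr' ?_
  filter_upwards [eventually_mem_nhdsLT_one] with k ⟨h0, h1⟩
  have hkp := comod_pos h0.le h1
  rw [delta_ampl_eq h0.le h1 hl0 hl1]
  simp only [Pi.div_apply]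
  have h2 : 0 < 1 + 2 * halfTan lam k ^ 2 + (comod k * halfTan lam k ^ 2) ^ 2 := by positivity
  have h3 : 0 < 1 + 2 * comod k ^ 2 * halfTan lam k ^ 2 + (comod k * halfTan lam k ^ 2) ^ 2 := by
    positivity
  rw [div_div_eq_mul_div]
  congr 1 <;> ring

theorem tendsto_exp_neg_logComod (hl0 : 0 < lam) :
    Tendsto (fun k => exp (-(2 * lam * logComod k))) (𝓝[<] 1) (𝓝 0) :=
  tendsto_exp_atBot.comp (tendsto_neg_atTop_atBot.comp
    (tendsto_logComod.const_mul_atTop (by linarith : 0 < 2 * lam)))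

theorem tendsto_delta_ampl_one (hl0 : 0 < lam) (hl1 : lam < 1 / 2) :
    Tendsto (fun k => delta k (ampl lam k)) (𝓝[<] 1) (𝓝 0) := by
  have h := (tendsto_exp_neg_logComod hl0).div (tendsto_exp_div_delta_ampl hl0 hl1) (by norm_num)
  rw [zero_div] at h
  refine h.congr' ?_
  filter_upwards [eventually_mem_nhdsLT_one] with k ⟨h0, h1⟩
  have := (delta_pos h0.le h1 (ampl lam k)).ne'
  have := exp_ne_zero (-(2 * lam * logComod k))
  simp only [Pi.div_apply]
  field_simp

/-- sin²α = (1 - Δ²)/k², and Δ → 0. -/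
theorem tendsto_sin_ampl_one (hl0 : 0 < lam) (hl1 : lam < 1 / 2) :
    Tendsto (fun k => sin (ampl lam k)) (𝓝[<] 1) (𝓝 1) := by
  have hk : Tendsto (fun k : ℝ => k) (𝓝[<] 1) (𝓝 1) := tendsto_id.mono_left nhdsWithin_le_nhds
  have h := (((tendsto_const_nhds (x := (1 : ℝ))).sub
    ((tendsto_delta_ampl_one hl0 hl1).pow 2)).div (hk.pow 2) (by norm_num)).sqrt
  norm_num at h
  refine h.congr' ?_
  filter_upwards [eventually_mem_nhdsLT_one] with k ⟨h0, h1⟩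
  have hmem := ampl_mem h0.le h1 hl0 hl1
  have hs : 0 ≤ sin (ampl lam k) :=
    sin_nonneg_of_nonneg_of_le_pi hmem.1.le (by linarith [hmem.2, pi_pos])
  rw [delta_sq h0.le h1, show (1 - (1 - k ^ 2 * sin (ampl lam k) ^ 2)) / k ^ 2 =
    sin (ampl lam k) ^ 2 by field_simp; ring, Real.sqrt_sq hs]

theorem sin_le_ellEinc {k φ : ℝ} (h0 : 0 ≤ k) (h1 : k < 1) (hφ : 0 ≤ φ) :
    sin φ ≤ ellEinc k φ := by
  have h := intervalIntegral.integral_mono_on (μ := volume) hφ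
    (continuous_cos.intervalIntegrable 0 φ)
    ((continuous_delta (k := k)).intervalIntegrable 0 φ) fun θ _ => cos_le_delta h0 h1 θ
  simpa [ellEinc, delta] using h

theorem ellE_le {k : ℝ} (h0 : 0 ≤ k) (h1 : k < 1) : ellE k ≤ 1 + comod k := by
  have hpi : (0 : ℝ) ≤ π / 2 := by positivity
  have hcont : Continuous fun θ => cos θ + comod k * sin θ := by fun_prop
  have h := intervalIntegral.integral_mono_on (μ := volume) hpi
    ((continuous_delta (k := k)).intervalIntegrable 0 (π / 2))
    (hcont.intervalIntegrable _ _) fun θ hθ => by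
      have hc := cos_nonneg_of_mem_Icc (x := θ) ⟨by linarith [hθ.1, pi_pos], hθ.2⟩
      have hs := sin_nonneg_of_nonneg_of_le_pi hθ.1 (by linarith [hθ.2, pi_pos])
      have hkp := (comod_pos h0 h1).le
      -- Δ² = cos² + k'² sin² is at most (cos + k' sin)², the cross term being nonnegative.
      refine le_of_sq_le_sq ?_ (by positivity)
      rw [delta_sq_eq h0 h1]
      nlinarith [mul_nonneg hc (mul_nonneg hkp hs)]
  rw [intervalIntegral.integral_add (continuous_cos.intervalIntegrable _ _)
    (Continuous.intervalIntegrable (by fun_prop) _ _),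
    intervalIntegral.integral_const_mul, integral_cos, integral_sin] at h
  simpa [ellE, delta] using h

theorem ellEinc_monotone (k : ℝ) : Monotone (ellEinc k) :=
  monotone_of_deriv_nonneg (fun φ => (hasDerivAt_ellEinc φ).differentiableAt) fun φ => by
    rw [(hasDerivAt_ellEinc φ).deriv]
    exact Real.sqrt_nonneg _

/-- sin α ≤ E(α) ≤ E, and both ends tend to 1. -/
theorem tendsto_zeta_one (hl0 : 0 < lam) (hl1 : lam < 1 / 2) :
    Tendsto (zeta lam) (𝓝[<] 1) (𝓝 (1 - 2 * lam)) := by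
  have hc := tendsto_comod_one.mono_right nhdsWithin_le_nhds
  have hc1 := (tendsto_const_nhds (x := (1 : ℝ))).add hc
  rw [add_zero] at hc1
  have hE : Tendsto ellE (𝓝[<] 1) (𝓝 1) := by
    refine tendsto_of_tendsto_of_tendsto_of_le_of_le' tendsto_const_nhds hc1 ?_ ?_
    · filter_upwards [eventually_mem_nhdsLT_one] with k ⟨h0, h1⟩
      simpa [ellEinc_pi_div_two] using sin_le_ellEinc h0.le h1 (φ := π / 2) (by positivity)
    · filter_upwards [eventually_mem_nhdsLT_one] with k ⟨h0, h1⟩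
      exact ellE_le h0.le h1
  have hEi : Tendsto (fun k => ellEinc k (ampl lam k)) (𝓝[<] 1) (𝓝 1) := by
    refine tendsto_of_tendsto_of_tendsto_of_le_of_le' (tendsto_sin_ampl_one hl0 hl1) hE ?_ ?_
    · filter_upwards [eventually_mem_nhdsLT_one] with k ⟨h0, h1⟩
      exact sin_le_ellEinc h0.le h1 (ampl_mem h0.le h1 hl0 hl1).1.le
    · filter_upwards [eventually_mem_nhdsLT_one] with k ⟨h0, h1⟩
      exact ellEinc_monotone k (ampl_mem h0.le h1 hl0 hl1).2.le
  simpa using! hEi.sub (hE.const_mul (2 * lam))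

theorem tendsto_zStar_mul_exp (hl0 : 0 < lam) (hl1 : lam < 1 / 2) :
    Tendsto (fun k => zStar lam k * exp (-(2 * lam * logComod k))) (𝓝[<] 1)
      (𝓝 (1 / 2 - lam)) := by
  have h1 : Tendsto (fun k => exp (-(2 * lam * logComod k)) * cos (ampl lam k)) (𝓝[<] 1) (𝓝 0) :=
    (tendsto_exp_neg_logComod hl0).zero_mul_isBoundedUnder_le
      (isBoundedUnder_of ⟨1, fun k => abs_cos_le_one _⟩)
  have h := h1.add (((tendsto_sin_ampl_one hl0 hl1).mul (tendsto_zeta_one hl0 hl1)).mul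
    (tendsto_exp_div_delta_ampl hl0 hl1))
  rw [show 0 + 1 * (1 - 2 * lam) * (1 / 2) = 1 / 2 - lam by ring] at h
  refine h.congr' ?_
  filter_upwards [eventually_mem_nhdsLT_one] with k ⟨h0, h1⟩
  rw [zStar_eq_ampl h0.le h1 hl0 hl1]
  ring

theorem rpow_four_div_comod {k : ℝ} (h0 : 0 ≤ k) (h1 : k < 1) :
    (4 / √(1 - k ^ 2)) ^ (2 * lam) = exp (2 * lam * logComod k) := by
  have hkp := comod_pos h0 h1
  rw [← comod, rpow_def_of_pos (by positivity), logComod, mul_comm]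

theorem isEquivalent_zStar (hl0 : 0 < lam) (hl1 : lam < 1 / 2) :
    zStar lam ~[𝓝[<] 1] fun k : ℝ => (1 / 2 - lam) * (4 / √(1 - k ^ 2)) ^ (2 * lam) := by
  have hl : 1 / 2 - lam ≠ 0 := by linarith
  refine (Asymptotics.isEquivalent_iff_tendsto_one ?_).2 ?_
  · filter_upwards [eventually_mem_nhdsLT_one] with k ⟨h0, h1⟩
    rw [rpow_four_div_comod h0.le h1]
    exact mul_ne_zero hl (exp_ne_zero _)
  · have h := (tendsto_zStar_mul_exp hl0 hl1).div_const (1 / 2 - lam)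
    rw [div_self hl] at h
    refine h.congr' ?_
    filter_upwards [eventually_mem_nhdsLT_one] with k ⟨h0, h1⟩
    simp only [Pi.div_apply]
    rw [rpow_four_div_comod h0.le h1, exp_neg]
    field_simp

theorem tendsto_zStar_one (hl0 : 0 < lam) (hl1 : lam < 1 / 2) :
    Tendsto (zStar lam) (𝓝[<] 1) atTop := by
  refine (isEquivalent_zStar hl0 hl1).symm.tendsto_atTop ?_
  have h := (tendsto_exp_atTop.comp (tendsto_logComod.const_mul_atTop
    (by linarith : 0 < 2 * lam))).const_mul_atTop (by linarith : 0 < 1 / 2 - lam)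
  refine h.congr' ?_
  filter_upwards [eventually_mem_nhdsLT_one] with k ⟨h0, h1⟩
  rw [rpow_four_div_comod h0.le h1]
  rfl

end LimitOne

end Jacobi

theorem theorem6 (lam : ℝ) (hlam0 : 0 < lam) (hlam1 : lam < 1 / 2) :
    (∀ k : ℝ, 0 < k → k < 1 →
      Jacobi.zStar lam k =
        Jacobi.cn k (2 * lam * Jacobi.ellK k) +
          Jacobi.sn k (2 * lam * Jacobi.ellK k) * Jacobi.zn k (2 * lam * Jacobi.ellK k) /
            Jacobi.dn k (2 * lam * Jacobi.ellK k)) ∧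
    StrictMonoOn (fun k : ℝ => Jacobi.zStar lam k) (Set.Ioo 0 1) ∧
    Filter.Tendsto (fun k : ℝ => Jacobi.zStar lam k) (𝓝[>] 0) (𝓝 (Real.cos (lam * Real.pi))) ∧
    Asymptotics.IsEquivalent (𝓝[<] 1) (fun k : ℝ => Jacobi.zStar lam k)
      (fun k : ℝ => (1 / 2 - lam) * (4 / √(1 - k ^ 2)) ^ (2 * lam)) ∧
    Filter.Tendsto (fun k : ℝ => Jacobi.zStar lam k) (𝓝[<] 1) Filter.atTop :=
  ⟨fun _ h0 h1 => Jacobi.zStar_eq h0.le h1 hlam0 (by linarith),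
    Jacobi.strictMonoOn_zStar hlam0 hlam1, Jacobi.tendsto_zStar_zero hlam0 hlam1,
    Jacobi.isEquivalent_zStar hlam0 hlam1, Jacobi.tendsto_zStar_one hlam0 hlam1⟩
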